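/- For each $n\ge 1$ let $C(z)=\frac{1}{\sqrt n}\sum_{1\le j<k\le n}J_{jk}z_jz_k$, $z\in\{+1,-1\}^n$, be the Sherrington–Kirkpatrick cost function, where the $J_{jk}$ are independent and identically distributed with an arbitrary fixed law on $\mathbb R$ (not depending on $n$) of mean $0$ and variance $1$ (for instance the standard normal law). View $C$ as the operator $C|z\rangle=C(z)|z\rangle$ on $n$ qubits, let $B=\sum_{j=1}^nX_j$ with $X_j$ the Pauli $X$ operator on qubit $j$, let $|s\rangle=2^{-n/2}\sum_z|z\rangle$, and for $\boldsymbol\gamma=(\gamma_1,\gamma_2)\in\mathbb R^2$, $\boldsymbol\beta=(\beta_1,\beta_2)\in\mathbb R^2$ let $$|\boldsymbol\gamma,\boldsymbol\beta\rangle=e^{-i\beta_2B}e^{-i\gamma_2C}e^{-i\beta_1B}e^{-i\gamma_1C}|s\rangle$$ be the QAOA state with $p=2$ layers. Then, for all real $\gamma_1,\gamma_2,\beta_1,\beta_2$, the random variable $\langle\boldsymbol\gamma,\boldsymbol\beta|C/n|\boldsymbol\gamma,\boldsymbol\beta\rangle$ is integrable for every $n$, the limit $V_2(\boldsymbol\gamma,\boldsymbol\beta)=\lim_{n\to\infty}\mathbb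 E_J\big[\langle\boldsymbol\gamma,\boldsymbol\beta|C/n|\boldsymbol\gamma,\boldsymbol\beta\rangle\big]$ exists, and $$V_2(\boldsymbol\gamma,\boldsymbol\beta)=\big[\gamma_1\Gamma_1+\gamma_2\Gamma_2\big]\exp\big(-2(\gamma_1^2+\gamma_2^2)\big),$$ where $$\Gamma_1=2\Big(e^{2\gamma_2^2}\sin2\beta_1\cos2\beta_2+\sin2\beta_2\,(\cos2\beta_1\cosh\Omega-\sinh\Omega)\Big)\Big(\cos2\beta_1\cos2\beta_2-e^{-2\gamma_2^2}\sin2\beta_1\sin2\beta_2\cos\Lambda\Big),$$ $$\Gamma_2=\Big(\cosh\Omega+e^{2\gamma_1^2}\sin2\beta_1\sin\Lambda-\cos2\beta_1\sinh\Omega\Big)\sin4\beta_2,$$ $$\Lambda=4\gamma_1\gamma_2\sin2\beta_1\,e^{-2\gamma_1^2},\qquad \Omega=4\gamma_1\gamma_2\cos2\beta_1.$$ -/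

import Mathlib

open MeasureTheory Matrix

noncomputable section

namespace SKQAOA

/-- Spin strings `z ∈ {+1, -1}ⁿ`; they label the computational basis of `n` qubits. -/
abbrev Spins (n : ℕ) : Type := Fin n → ℤˣ

/-- Index set of the couplings: the pairs `(j, k)` with `j < k`. -/
abbrev Pairs (n : ℕ) : Type := {e : Fin n × Fin n // e.1 < e.2}

/-- State vectors of `n` qubits, in the computational basis. -/
abbrev State (n : ℕ) : Type := Spins n → ℂ

/-- Operators on `n` qubits, in the computational basis. -/
abbrev Op (n : ℕ) : Type := Matrix (Spins n) (Spins n) ℂ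

/-- The Sherrington-Kirkpatrick cost function `C(z) = n^{-1/2} ∑_{j<k} J_{jk} z_j z_k`. -/
def cost {n : ℕ} (J : Pairs n → ℝ) (z : Spins n) : ℝ :=
  (1 / Real.sqrt n) * ∑ e : Pairs n, J e * ((z e.1.1 : ℤ) : ℝ) * ((z e.1.2 : ℤ) : ℝ)

/-- The diagonal operator `C |z⟩ = C(z) |z⟩`. -/
def costOp {n : ℕ} (J : Pairs n → ℝ) : Op n :=
  Matrix.diagonal fun z => (cost J z : ℂ)

/-- The Pauli `X` operator on qubit `j`: it maps `|z⟩` to `|z with z_j negated⟩`. -/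
def pauliX {n : ℕ} (j : Fin n) : Op n :=
  Matrix.of fun z z' => if z = Function.update z' j (-z' j) then 1 else 0

/-- The mixing operator `B = ∑_j X_j`. -/
def mixOp (n : ℕ) : Op n := ∑ j : Fin n, pauliX j

/-- `U(C, γ) = e^{-iγC}` (matrix exponential). -/
def costUnitary {n : ℕ} (J : Pairs n → ℝ) (γ : ℝ) : Op n :=
  NormedSpace.exp ((-(Complex.I * (γ : ℂ))) • costOp J)

/-- `U(B, β) = e^{-iβB}` (matrix exponential). -/
def mixUnitary (n : ℕ) (β : ℝ) : Op n :=
  NormedSpace.exp ((-(Complex.I * (β : ℂ))) • mixOp n)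

/-- The uniform superposition `|s⟩ = 2^{-n/2} ∑_z |z⟩`. -/
def plusState (n : ℕ) : State n := fun _ => ((1 / Real.sqrt (2 ^ n) : ℝ) : ℂ)

/-- The QAOA state
`|γ, β⟩ = U(B, β_p) U(C, γ_p) ⋯ U(B, β_1) U(C, γ_1) |s⟩`; the parameters of layer `r`
are stored at index `r - 1`. -/
def qaoaState {n : ℕ} (J : Pairs n → ℝ) : (p : ℕ) → (Fin p → ℝ) → (Fin p → ℝ) → State n
  | 0, _, _ => plusState n
  | p + 1, γ, β =>
      mixUnitary n (β (Fin.last p)) *ᵥ (costUnitary J (γ (Fin.last p)) *ᵥ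
        qaoaState J p (fun r => γ r.castSucc) (fun r => β r.castSucc))

/-- The quantum expectation `⟨γ, β| C/n |γ, β⟩`. -/
def energyDensity {n : ℕ} (J : Pairs n → ℝ) (p : ℕ) (γ β : Fin p → ℝ) : ℂ :=
  star (qaoaState J p γ β) ⬝ᵥ (((1 / (n : ℂ)) • costOp J) *ᵥ qaoaState J p γ β)

/-- The law of the couplings `J_{jk}`, `j < k`: independent, each with law `μ`. -/
def couplingLaw (μ : Measure ℝ) (n : ℕ) : Measure (Pairs n → ℝ) :=
  Measure.pi fun _ => μ

/-- `Λ = 4 γ₁ γ₂ sin 2β₁ exp(-2γ₁²)` -/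
def Lam (γ₁ γ₂ β₁ : ℝ) : ℝ :=
  4 * γ₁ * γ₂ * Real.sin (2 * β₁) * Real.exp (-2 * γ₁ ^ 2)

/-- `Ω = 4 γ₁ γ₂ cos 2β₁` -/
def Omg (γ₁ γ₂ β₁ : ℝ) : ℝ :=
  4 * γ₁ * γ₂ * Real.cos (2 * β₁)

def Gamma1 (γ₁ γ₂ β₁ β₂ : ℝ) : ℝ :=
  2 * (Real.exp (2 * γ₂ ^ 2) * Real.sin (2 * β₁) * Real.cos (2 * β₂)
      + Real.sin (2 * β₂) * (Real.cos (2 * β₁) * Real.cosh (Omg γ₁ γ₂ β₁)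
          - Real.sinh (Omg γ₁ γ₂ β₁)))
    * (Real.cos (2 * β₁) * Real.cos (2 * β₂)
      - Real.exp (-2 * γ₂ ^ 2) * Real.sin (2 * β₁) * Real.sin (2 * β₂)
          * Real.cos (Lam γ₁ γ₂ β₁))

def Gamma2 (γ₁ γ₂ β₁ β₂ : ℝ) : ℝ :=
  (Real.cosh (Omg γ₁ γ₂ β₁)
      + Real.exp (2 * γ₁ ^ 2) * Real.sin (2 * β₁) * Real.sin (Lam γ₁ γ₂ β₁)
      - Real.cos (2 * β₁) * Real.sinh (Omg γ₁ γ₂ β₁))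
    * Real.sin (4 * β₂)

end SKQAOA

end

/-!
Expanding each mixer in the computational basis writes the expectation of one term `J_e z_j z_k` of
the cost function as a sum over spin histories: every qubit carries a ket spin and a bra spin at
each of the two cost layers, with a weight that factors over the qubits, and the couplings enter
only through `J_e exp (i ∑ J φ / √n)`, where the phase `φ` is real. Averaging replaces the coupling
of a pair by the characteristic function of the law at `φ / √n`, and the measured coupling by its
derivative there. Both are symmetric in the pair, so by exchangeability all pairs `e` contribute
equally, and there are about `n ^ 2 / 2` of them.

For a qubit that is not measured, unitarity of the last mixer forces the ket and bra spins of the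
second layer to agree. Two such qubits then interact only if exactly one of them has disagreeing
first-layer spins, in which case the squared phase is `4 γ₁ ^ 2`. Apart from the coupling to the
measured qubits, the weights of disagreeing spins cancel by unitarity of the first mixer, so they
have total weight `O(1/n)`: only boundedly many qubits disagree, and each picks up the factor
`(1 - 2 γ₁ ^ 2 / n) ^ n ≈ exp (-2 γ₁ ^ 2)` from the others. The sum over the unmeasured qubits
therefore tends to the exponential of an expression that is additive over the two measured qubits,
and the remaining sum over the histories of these two factors.
-/

namespace SKQAOA

open Filter Topology

/-! ### The QAOA state as a sum over paths -/

section Involution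

theorem exp_smul_of_mul_self_eq_one {A : Type*} [NormedRing A] [NormedAlgebra ℂ A]
    [CompleteSpace A] {x : A} (hx : x * x = 1) (t : ℂ) :
    NormedSpace.exp (t • x) = Complex.cosh t • (1 : A) + Complex.sinh t • x := by
  have x_pow_even (k : ℕ) : x ^ (2 * k) = 1 := by rw [pow_mul, pow_two, hx, one_pow]
  refine (NormedSpace.exp_series_hasSum_exp' (𝕂 := ℂ) (t • x)).unique (HasSum.even_add_odd ?_ ?_)
  · refine ((Complex.hasSum_cosh t).smul_const (1 : A)).congr_fun fun k => ?_
    rw [smul_pow, x_pow_even, smul_smul, inv_mul_eq_div]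
  · refine ((Complex.hasSum_sinh t).smul_const x).congr_fun fun k => ?_
    rw [smul_pow, pow_succ x, x_pow_even, smul_smul, one_mul, inv_mul_eq_div]

theorem matrix_exp_smul_of_mul_self_eq_one {m : Type*} [Fintype m] [DecidableEq m]
    {X : Matrix m m ℂ} (hX : X * X = 1) (t : ℂ) :
    NormedSpace.exp (t • X) = Complex.cosh t • (1 : Matrix m m ℂ) + Complex.sinh t • X := by
  open scoped Matrix.Norms.Operator in
  exact exp_smul_of_mul_self_eq_one hX t

end Involution

theorem sum_units {M : Type*} [AddCommMonoid M] (f : ℤˣ → M) (z : ℤˣ) :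
    ∑ w, f w = f z + f (-z) := by
  rcases Int.units_eq_one_or z with rfl | rfl <;> simp [add_comm]

theorem eq_or_eq_neg_units (z w : ℤˣ) : z = w ∨ z = -w := by
  rcases Int.units_eq_one_or z with rfl | rfl <;> rcases Int.units_eq_one_or w with rfl | rfl <;>
    simp

section Mixer

/-- The matrix elements of the single-qubit unitary `exp (-iβX)`. -/
noncomputable def mixKernel (β : ℝ) (z w : ℤˣ) : ℂ :=
  if z = w then (Real.cos β : ℂ) else -(Complex.I * Real.sin β)

theorem mixKernel_self (β : ℝ) (z : ℤˣ) : mixKernel β z z = Real.cos β := if_pos rfl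

theorem mixKernel_neg_right (β : ℝ) (z : ℤˣ) :
    mixKernel β z (-z) = -(Complex.I * Real.sin β) := if_neg (units_ne_neg_self z)

theorem mixKernel_neg_left (β : ℝ) (z : ℤˣ) :
    mixKernel β (-z) z = -(Complex.I * Real.sin β) := if_neg (units_ne_neg_self z).symm

variable {n : ℕ}

theorem pauliX_apply (j : Fin n) (z w : Spins n) :
    pauliX j z w = if w = Function.update z j (-z j) then 1 else 0 := by
  have flip_iff : z = Function.update w j (-w j) ↔ w = Function.update z j (-z j) := by
    constructor <;> rintro rfl <;> simp
  simp only [pauliX, Matrix.of_apply, flip_iff]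

theorem pauliX_mul_apply (j : Fin n) (M : Op n) (z w : Spins n) :
    (pauliX j * M) z w = M (Function.update z j (-z j)) w := by
  simp only [Matrix.mul_apply, pauliX_apply, ite_mul, one_mul, zero_mul, Finset.sum_ite_eq',
    Finset.mem_univ, if_true]

theorem pauliX_mul_self (j : Fin n) : pauliX j * pauliX j = (1 : Op n) := by
  ext z w
  simp [pauliX_mul_apply, pauliX_apply, Matrix.one_apply, eq_comm]

theorem pauliX_commute (j k : Fin n) : Commute (pauliX j) (pauliX (n := n) k) := by
  rcases eq_or_ne j k with rfl | h
  · exact Commute.refl _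
  · ext z w
    simp [pauliX_mul_apply, pauliX_apply, h, h.symm, Function.update_comm h]

theorem exp_pauliX_mul_apply (β : ℝ) (j : Fin n) (M : Op n) (z w : Spins n) :
    (NormedSpace.exp ((-(Complex.I * (β : ℂ))) • pauliX j) * M) z w =
      ∑ y, mixKernel β (z j) y * M (Function.update z j y) w := by
  have cosh_eq : Complex.cosh (-(Complex.I * β)) = Real.cos β := by
    rw [Complex.cosh_neg, mul_comm, Complex.cosh_mul_I, Complex.ofReal_cos]
  have sinh_eq : Complex.sinh (-(Complex.I * β)) = -(Complex.I * Real.sin β) := by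
    rw [Complex.sinh_neg, mul_comm, Complex.sinh_mul_I, mul_comm, Complex.ofReal_sin]
  rw [matrix_exp_smul_of_mul_self_eq_one (pauliX_mul_self j), add_mul, smul_mul_assoc,
    smul_mul_assoc, one_mul, Matrix.add_apply, Matrix.smul_apply, Matrix.smul_apply,
    pauliX_mul_apply, sum_units _ (z j), mixKernel_self, mixKernel_neg_right,
    Function.update_eq_self, cosh_eq, sinh_eq, smul_eq_mul, smul_eq_mul]

theorem exp_sum_pauliX_apply (β : ℝ) (s : Finset (Fin n)) (z w : Spins n) :
    (NormedSpace.exp ((-(Complex.I * (β : ℂ))) • ∑ j ∈ s, pauliX j) : Op n) z w =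
      ∏ j, if j ∈ s then mixKernel β (z j) (w j) else if z j = w j then 1 else 0 := by
  induction s using Finset.induction_on generalizing z with
  | empty => simp [Matrix.one_apply, Finset.prod_ite_zero, funext_iff]
  | insert k s hk ih =>
    have commutes : Commute (pauliX k) (∑ j ∈ s, pauliX (n := n) j) :=
      Commute.sum_right _ _ _ fun j _ => pauliX_commute k j
    rw [Finset.sum_insert hk, smul_add,
      Matrix.exp_add_of_commute _ _ ((commutes.smul_left _).smul_right _),
      exp_pauliX_mul_apply, Fintype.sum_eq_single (w k)]
    · rw [ih, ← Finset.mul_prod_erase _ _ (Finset.mem_univ k),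
        ← Finset.mul_prod_erase _ _ (Finset.mem_univ k), if_neg hk, Function.update_self,
        if_pos rfl, one_mul, if_pos (Finset.mem_insert_self k s)]
      congr 1
      refine Finset.prod_congr rfl fun j hj => ?_
      have hjk : j ≠ k := Finset.ne_of_mem_erase hj
      simp only [Function.update_of_ne hjk, Finset.mem_insert, hjk, false_or]
    · intro y hy
      rw [ih, Finset.prod_eq_zero (Finset.mem_univ k) (by simp [hk, hy]), mul_zero]

theorem mixUnitary_apply (β : ℝ) (z w : Spins n) :
    mixUnitary n β z w = ∏ j, mixKernel β (z j) (w j) := by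
  rw [mixUnitary, mixOp, exp_sum_pauliX_apply]
  simp only [Finset.mem_univ, if_true]

theorem costUnitary_mulVec_apply (J : Pairs n → ℝ) (γ : ℝ) (ψ : State n) (z : Spins n) :
    (costUnitary J γ *ᵥ ψ) z = Complex.exp (-(Complex.I * γ) * cost J z) * ψ z := by
  rw [costUnitary, costOp, ← Matrix.diagonal_smul, Matrix.exp_diagonal, Matrix.mulVec_diagonal]
  simp [Complex.exp_eq_exp_ℂ]

theorem qaoaState_succ_apply (J : Pairs n → ℝ) (p : ℕ) (γ β : Fin (p + 1) → ℝ) (z : Spins n) :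
    qaoaState J (p + 1) γ β z = ∑ w : Spins n, (∏ j, mixKernel (β (Fin.last p)) (z j) (w j)) *
      (Complex.exp (-(Complex.I * γ (Fin.last p)) * cost J w) *
        qaoaState J p (fun r => γ r.castSucc) (fun r => β r.castSucc) w) := by
  simp only [qaoaState]
  rw [Matrix.mulVec, dotProduct]
  simp only [mixUnitary_apply, costUnitary_mulVec_apply]

end Mixer

section PathSum

/-- The real value of a spin. -/
def spinVal (z : ℤˣ) : ℝ := ((z : ℤ) : ℝ)

theorem spinVal_neg (z : ℤˣ) : spinVal (-z) = -spinVal z := by simp [spinVal]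

theorem spinVal_mul_self (z : ℤˣ) : spinVal z * spinVal z = 1 := by
  rcases Int.units_eq_one_or z with rfl | rfl <;> simp [spinVal]

theorem ofReal_spinVal_mul_self (z : ℤˣ) : (spinVal z : ℂ) * spinVal z = 1 :=
  mod_cast spinVal_mul_self z

/-- The pair (ket spin, bra spin) of one qubit at one time slice. -/
abbrev KetBra : Type := ℤˣ × ℤˣ

/-- The history of one qubit through a two-layer circuit: its spins at the times when the first
and the second cost unitary act, in this order. -/
abbrev SpinPath : Type := KetBra × KetBra

/-- The matrix elements of the single-qubit channel `ρ ↦ exp (-iβX) ρ exp (iβX)`. -/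
noncomputable def mixTransfer (β : ℝ) (b c : KetBra) : ℂ :=
  mixKernel β b.1 c.1 * starRingEnd ℂ (mixKernel β b.2 c.2)

/-- `layerPhase γ b c` is the coefficient of `J_{jk} / √n` in the phase which one cost unitary
contributes when the qubits `j` and `k` are in the states `b` and `c`. -/
def layerPhase (γ : ℝ) (b c : KetBra) : ℝ :=
  γ * (spinVal b.2 * spinVal c.2 - spinVal b.1 * spinVal c.1)

/-- The coefficient of `J_{jk} / √n` in the phase of two qubits with histories `p` and `q`. -/
def phase (γ₁ γ₂ : ℝ) (p q : SpinPath) : ℝ :=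
  layerPhase γ₁ p.1 q.1 + layerPhase γ₂ p.2 q.2

/-- The amplitude of the history `q` of one qubit that ends in the spin `z`; the factor `1 / 2`
comes from the initial state. -/
noncomputable def pathAmp (β₁ β₂ : ℝ) (z : ℤˣ) (q : SpinPath) : ℂ :=
  mixTransfer β₂ (z, z) q.2 * (mixTransfer β₁ q.2 q.1 * (1 / 2))

/-- The total amplitude of the history `q` of a qubit that is not measured. -/
noncomputable def bulkWeight (β₁ β₂ : ℝ) (q : SpinPath) : ℂ := ∑ z, pathAmp β₁ β₂ z q

/-- The total amplitude of the history `q` of a qubit on which Pauli `Z` is measured. -/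
noncomputable def coreWeight (β₁ β₂ : ℝ) (q : SpinPath) : ℂ :=
  ∑ z, (spinVal z : ℂ) * pathAmp β₁ β₂ z q

theorem sum_prodMk_eq {ι α β M : Type*} [Fintype ι] [DecidableEq ι] [Fintype α] [Fintype β]
    [AddCommMonoid M] (F : (ι → α) → (ι → β) → M) :
    ∑ q : ι → α × β, F (fun i => (q i).1) (fun i => (q i).2) = ∑ x, ∑ y, F x y := by
  rw [← Fintype.sum_prod_type' F,
    ← (Equiv.arrowProdEquivProdArrow ι (fun _ => α) (fun _ => β)).sum_comp]
  rfl

variable {n : ℕ}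

theorem cost_eq_sum (J : Pairs n → ℝ) (z : Spins n) :
    cost J z = ∑ e : Pairs n, J e * (spinVal (z e.1.1) * spinVal (z e.1.2) / Real.sqrt n) := by
  simp only [cost, spinVal, Finset.mul_sum]
  exact Finset.sum_congr rfl fun e _ => by ring

theorem mul_cost_sub_cost (J : Pairs n → ℝ) (γ : ℝ) (c : Fin n → KetBra) :
    γ * (cost J (fun j => (c j).2) - cost J (fun j => (c j).1)) =
      ∑ e : Pairs n, J e * (layerPhase γ (c e.1.1) (c e.1.2) / Real.sqrt n) := by
  simp only [cost_eq_sum, ← Finset.sum_sub_distrib, Finset.mul_sum, layerPhase]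
  exact Finset.sum_congr rfl fun e _ => by ring

/-- The matrix element of `|γ, β⟩⟨γ, β|` in row `j ↦ (b j).1` and column `j ↦ (b j).2`. -/
noncomputable def densityEntry (J : Pairs n → ℝ) (p : ℕ) (γ β : Fin p → ℝ)
    (b : Fin n → KetBra) : ℂ :=
  qaoaState J p γ β (fun j => (b j).1) * starRingEnd ℂ (qaoaState J p γ β fun j => (b j).2)

theorem densityEntry_zero (J : Pairs n → ℝ) (γ β : Fin 0 → ℝ) (b : Fin n → KetBra) :
    densityEntry J 0 γ β b = ∏ _j : Fin n, (1 / 2 : ℂ) := by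
  rw [densityEntry, qaoaState, plusState, plusState, Complex.conj_ofReal, ← Complex.ofReal_mul,
    div_mul_div_comm, Real.mul_self_sqrt (by positivity)]
  simp

theorem densityEntry_succ (J : Pairs n → ℝ) (p : ℕ) (γ β : Fin (p + 1) → ℝ)
    (b : Fin n → KetBra) :
    densityEntry J (p + 1) γ β b = ∑ c : Fin n → KetBra,
      (∏ j, mixTransfer (β (Fin.last p)) (b j) (c j)) *
        (Complex.exp ((∑ e : Pairs n, J e *
            (layerPhase (γ (Fin.last p)) (c e.1.1) (c e.1.2) / Real.sqrt n) : ℝ) * Complex.I) *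
          densityEntry J p (fun r => γ r.castSucc) (fun r => β r.castSucc) c) := by
  simp only [densityEntry, qaoaState_succ_apply, map_sum, Finset.sum_mul_sum]
  rw [← sum_prodMk_eq]
  refine Finset.sum_congr rfl fun c _ => ?_
  rw [← mul_cost_sub_cost]
  simp only [mixTransfer, Finset.prod_mul_distrib, map_mul, map_prod, ← Complex.exp_conj, map_neg,
    Complex.conj_I, Complex.conj_ofReal]
  have exp_eq (s t γ : ℝ) : Complex.exp ((γ * (t - s) : ℝ) * Complex.I) =
      Complex.exp (-(Complex.I * γ) * s) * Complex.exp (-(-Complex.I * γ) * t) := by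
    rw [← Complex.exp_add]
    congr 1
    push_cast
    ring
  rw [exp_eq]
  ring

theorem densityEntry_two (J : Pairs n → ℝ) (γ₁ γ₂ β₁ β₂ : ℝ) (b : Fin n → KetBra) :
    densityEntry J 2 ![γ₁, γ₂] ![β₁, β₂] b = ∑ q : Fin n → SpinPath,
      (∏ j, mixTransfer β₂ (b j) (q j).2 * (mixTransfer β₁ (q j).2 (q j).1 * (1 / 2))) *
        Complex.exp ((∑ e : Pairs n, J e *
          (phase γ₁ γ₂ (q e.1.1) (q e.1.2) / Real.sqrt n) : ℝ) * Complex.I) := by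
  simp only [densityEntry_succ, densityEntry_zero, Finset.mul_sum,
    show Fin.last 1 = (1 : Fin 2) from rfl, show (Fin.last 0).castSucc = (0 : Fin 2) from rfl,
    Matrix.cons_val_zero, Matrix.cons_val_one]
  rw [Finset.sum_comm, ← sum_prodMk_eq]
  refine Finset.sum_congr rfl fun q _ => ?_
  have exp_eq : Complex.exp ((∑ e : Pairs n, J e *
        (phase γ₁ γ₂ (q e.1.1) (q e.1.2) / Real.sqrt n) : ℝ) * Complex.I) =
      Complex.exp ((∑ e : Pairs n, J e *
        (layerPhase γ₁ (q e.1.1).1 (q e.1.2).1 / Real.sqrt n) : ℝ) * Complex.I) *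
      Complex.exp ((∑ e : Pairs n, J e *
        (layerPhase γ₂ (q e.1.1).2 (q e.1.2).2 / Real.sqrt n) : ℝ) * Complex.I) := by
    simp only [phase, add_div, mul_add, Finset.sum_add_distrib, Complex.ofReal_add, add_mul,
      Complex.exp_add]
  rw [exp_eq, Finset.prod_mul_distrib, Finset.prod_mul_distrib]
  ring

theorem energyDensity_eq_sum (J : Pairs n → ℝ) (p : ℕ) (γ β : Fin p → ℝ) :
    energyDensity J p γ β =
      1 / (n : ℂ) * ∑ z : Spins n, cost J z * densityEntry J p γ β fun j => (z j, z j) := by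
  rw [energyDensity, costOp, ← Matrix.diagonal_smul, dotProduct, Finset.mul_sum]
  refine Finset.sum_congr rfl fun z _ => ?_
  rw [Matrix.mulVec_diagonal, Pi.star_apply, Complex.star_def, densityEntry, Pi.smul_apply,
    smul_eq_mul]
  ring

theorem prod_ite_mem_pair {M : Type*} [CommMonoid M] (e : Pairs n) (f : Fin n → M) :
    (∏ j, if j = e.1.1 ∨ j = e.1.2 then f j else 1) = f e.1.1 * f e.1.2 := by
  have filter_eq : (Finset.univ.filter fun j => j = e.1.1 ∨ j = e.1.2) = {e.1.1, e.1.2} := by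
    ext
    simp
  rw [← Finset.prod_filter, filter_eq, Finset.prod_pair e.2.ne]

theorem sum_spinVal_mul_prod_pathAmp (β₁ β₂ : ℝ) (e : Pairs n) (q : Fin n → SpinPath) :
    ∑ z : Spins n, (spinVal (z e.1.1) * spinVal (z e.1.2) : ℂ) *
        ∏ j, pathAmp β₁ β₂ (z j) (q j) =
      ∏ j, if j = e.1.1 ∨ j = e.1.2 then coreWeight β₁ β₂ (q j) else bulkWeight β₁ β₂ (q j) := by
  have prod_eq (z : Spins n) : (spinVal (z e.1.1) * spinVal (z e.1.2) : ℂ) *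
      ∏ j, pathAmp β₁ β₂ (z j) (q j) =
      ∏ j, (if j = e.1.1 ∨ j = e.1.2 then (spinVal (z j) : ℂ) else 1) *
        pathAmp β₁ β₂ (z j) (q j) := by
    rw [Finset.prod_mul_distrib, prod_ite_mem_pair]
  simp only [prod_eq]
  rw [← Fintype.prod_sum fun j z => (if j = e.1.1 ∨ j = e.1.2 then (spinVal z : ℂ) else 1) *
    pathAmp β₁ β₂ z (q j)]
  refine Finset.prod_congr rfl fun j _ => ?_
  split_ifs <;> simp only [coreWeight, bulkWeight, one_mul]

theorem energyDensity_two_eq (J : Pairs n → ℝ) (γ₁ γ₂ β₁ β₂ : ℝ) :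
    energyDensity J 2 ![γ₁, γ₂] ![β₁, β₂] =
      1 / (n : ℂ) * (1 / Real.sqrt n : ℝ) * ∑ e : Pairs n, ∑ q : Fin n → SpinPath,
        (∏ j, if j = e.1.1 ∨ j = e.1.2 then coreWeight β₁ β₂ (q j) else bulkWeight β₁ β₂ (q j)) *
        (J e * Complex.exp ((∑ e' : Pairs n, J e' *
          (phase γ₁ γ₂ (q e'.1.1) (q e'.1.2) / Real.sqrt n) : ℝ) * Complex.I)) := by
  rw [energyDensity_eq_sum, mul_assoc]
  congr 1
  simp only [densityEntry_two, ← sum_spinVal_mul_prod_pathAmp, Finset.sum_mul]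
  simp only [cost, Complex.ofReal_mul, Complex.ofReal_sum, Finset.sum_mul, Finset.mul_sum]
  rw [Finset.sum_comm_cycle]
  refine Finset.sum_congr rfl fun e _ => ?_
  rw [Finset.sum_comm]
  refine Finset.sum_congr rfl fun q _ => Finset.sum_congr rfl fun z _ => ?_
  simp only [spinVal, pathAmp]
  push_cast
  ring

end PathSum

/-! ### Averaging over the disorder -/

section DisorderAverage

theorem integrable_mul_exp_mul_I {μ : Measure ℝ} (hμ : Integrable (fun x : ℝ => x) μ) (s : ℝ) :
    Integrable (fun x : ℝ => (x : ℂ) * Complex.exp ((x * s : ℝ) * Complex.I)) μ :=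
  hμ.ofReal.mul_bdd (c := 1) (Continuous.aestronglyMeasurable (by fun_prop))
    (Eventually.of_forall fun _ => (Complex.norm_exp_ofReal_mul_I _).le)

theorem integral_mul_exp_mul_I {μ : Measure ℝ} [IsFiniteMeasure μ]
    (hμ : Integrable (fun x : ℝ => x) μ) (s : ℝ) :
    ∫ x, (x : ℂ) * Complex.exp ((x * s : ℝ) * Complex.I) ∂μ =
      -Complex.I * deriv (charFun μ) s := by
  have deriv_eq := iteratedDeriv_charFun (μ := μ) (n := 1) (t := s)
    (by simpa [Function.id_def] using memLp_one_iff_integrable.2 hμ)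
  rw [← iteratedDeriv_one, deriv_eq, pow_one, ← mul_assoc, neg_mul, Complex.I_mul_I, neg_neg,
    one_mul]
  refine integral_congr_ae (Eventually.of_forall fun x => ?_)
  simp only [pow_one, Complex.ofReal_mul, mul_comm]

variable {ι : Type*} [Fintype ι] {μ : ι → Measure ℝ}
  [∀ i, IsProbabilityMeasure (μ i)]

theorem mul_exp_sum_eq_prod [DecidableEq ι] (θ : ι → ℝ) (e : ι) (J : ι → ℝ) :
    (J e : ℂ) * Complex.exp ((∑ e', J e' * θ e' : ℝ) * Complex.I) =
      ∏ e', (if e' = e then (J e' : ℂ) else 1) *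
        Complex.exp ((J e' * θ e' : ℝ) * Complex.I) := by
  rw [Finset.prod_mul_distrib, ← Complex.exp_sum, ← Finset.sum_mul, ← Complex.ofReal_sum]
  simp

theorem integrable_mul_exp_sum {e : ι} (hμ : Integrable (fun x : ℝ => x) (μ e)) (θ : ι → ℝ) :
    Integrable (fun J : ι → ℝ =>
      (J e : ℂ) * Complex.exp ((∑ e', J e' * θ e' : ℝ) * Complex.I)) (Measure.pi μ) := by
  classical
  simp only [mul_exp_sum_eq_prod]
  refine Integrable.fintype_prod (f := fun e' (x : ℝ) =>
    (if e' = e then (x : ℂ) else 1) * Complex.exp ((x * θ e' : ℝ) * Complex.I)) fun e' => ?_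
  split_ifs with h
  · exact h ▸ integrable_mul_exp_mul_I hμ _
  · refine Integrable.mul_bdd (c := 1) (integrable_const 1)
      (Continuous.aestronglyMeasurable (by fun_prop))
      (Eventually.of_forall fun _ => (Complex.norm_exp_ofReal_mul_I _).le)

theorem integral_mul_exp_sum [DecidableEq ι] {e : ι}
    (hμ : Integrable (fun x : ℝ => x) (μ e)) (θ : ι → ℝ) :
    ∫ J : ι → ℝ, (J e : ℂ) * Complex.exp ((∑ e', J e' * θ e' : ℝ) * Complex.I) ∂Measure.pi μ =
      ∏ e', if e' = e then -Complex.I * deriv (charFun (μ e')) (θ e')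
        else charFun (μ e') (θ e') := by
  simp only [mul_exp_sum_eq_prod]
  rw [integral_fintype_prod_eq_prod fun e' (x : ℝ) =>
    (if e' = e then (x : ℂ) else 1) * Complex.exp ((x * θ e' : ℝ) * Complex.I)]
  refine Finset.prod_congr rfl fun e' _ => ?_
  split_ifs with h
  · exact integral_mul_exp_mul_I (h ▸ hμ) _
  · simp only [charFun_apply_real, one_mul, Complex.ofReal_mul, mul_comm (θ e' : ℂ)]

end DisorderAverage

section Rescaling

theorem tendsto_inv_sqrt_natCast_nhdsGT :
    Tendsto (fun n : ℕ => (Real.sqrt n)⁻¹) atTop (𝓝[>] 0) :=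
  tendsto_inv_atTop_nhdsGT_zero.comp (Real.tendsto_sqrt_atTop.comp tendsto_natCast_atTop_atTop)

theorem tendsto_div_sqrt_natCast (t : ℝ) :
    Tendsto (fun n : ℕ => t / Real.sqrt n) atTop (𝓝 0) := by
  simpa [div_eq_mul_inv] using
    (tendsto_inv_sqrt_natCast_nhdsGT.mono_right nhdsWithin_le_nhds).const_mul t

variable {E : Type*} [NormedAddCommGroup E] [NormedSpace ℝ E]

theorem tendsto_sqrt_smul_sub_of_hasDerivAt {h : ℝ → E} {h' : E} (hh : HasDerivAt h h' 0)
    (t : ℝ) :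
    Tendsto (fun n : ℕ => Real.sqrt n • (h (t / Real.sqrt n) - h 0)) atTop (𝓝 (t • h')) := by
  have scaled : HasDerivAt (fun s => h (t * s)) (t • h') 0 := by
    refine HasDerivAt.scomp (h := fun s => t * s) 0 (by simpa using hh) ?_
    simpa using (hasDerivAt_id (0 : ℝ)).const_mul t
  refine (scaled.tendsto_slope_zero_right.comp tendsto_inv_sqrt_natCast_nhdsGT).congr fun n => ?_
  simp [div_eq_mul_inv]

theorem tendsto_natCast_smul_of_isLittleO_sq {f : ℝ → E} (hf : f =o[𝓝 0] fun s => s ^ 2)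
    (t : ℝ) :
    Tendsto (fun n : ℕ => (n : ℝ) • f (t / Real.sqrt n)) atTop (𝓝 0) := by
  rw [← Asymptotics.isLittleO_one_iff ℝ]
  refine ((Asymptotics.isBigO_refl (fun n : ℕ => (n : ℝ)) atTop).smul_isLittleO
    (hf.comp_tendsto (tendsto_div_sqrt_natCast t))).trans_isBigO ?_
  refine (Asymptotics.isBigO_const_const (t ^ 2) one_ne_zero atTop).congr' ?_ EventuallyEq.rfl
  filter_upwards [eventually_gt_atTop 0] with n hn
  have n_pos : (0 : ℝ) < n := Nat.cast_pos.2 hn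
  rw [Function.comp_apply, smul_eq_mul, div_pow, Real.sq_sqrt n_pos.le,
    mul_div_cancel₀ _ n_pos.ne']

variable {𝕜 : Type*} [RCLike 𝕜] {x y : ℕ → 𝕜} {a b : 𝕜}

theorem tendsto_zero_of_tendsto_natCast_mul
    (hx : Tendsto (fun n : ℕ => (n : 𝕜) * x n) atTop (𝓝 a)) : Tendsto x atTop (𝓝 0) := by
  have h := (tendsto_inv_atTop_nhds_zero_nat (𝕜 := 𝕜)).mul hx
  rw [zero_mul] at h
  refine h.congr' ?_
  filter_upwards [eventually_ne_atTop 0] with n hn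
  exact inv_mul_cancel_left₀ (Nat.cast_ne_zero.2 hn) _

theorem tendsto_natCast_mul_comp_add
    (hx : Tendsto (fun n : ℕ => (n : 𝕜) * x n) atTop (𝓝 a)) (k : ℕ) :
    Tendsto (fun n : ℕ => (n : 𝕜) * x (n + k)) atTop (𝓝 a) := by
  have h := (hx.comp (tendsto_add_atTop_nat k)).sub
    (((tendsto_zero_of_tendsto_natCast_mul hx).comp (tendsto_add_atTop_nat k)).const_mul (k : 𝕜))
  rw [mul_zero, sub_zero] at h
  refine h.congr fun n => ?_
  simp only [Function.comp_apply, Nat.cast_add]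
  ring

theorem tendsto_natCast_mul_mul_sub_one
    (hx : Tendsto (fun n : ℕ => (n : 𝕜) * (x n - 1)) atTop (𝓝 a))
    (hy : Tendsto (fun n : ℕ => (n : 𝕜) * (y n - 1)) atTop (𝓝 b)) :
    Tendsto (fun n : ℕ => (n : 𝕜) * (x n * y n - 1)) atTop (𝓝 (a + b)) := by
  have h := (hx.mul ((tendsto_zero_of_tendsto_natCast_mul hy).add_const 1)).add hy
  rw [zero_add, mul_one] at h
  exact h.congr fun n => by ring

end Rescaling

section CharFun

variable {μ : Measure ℝ} [IsProbabilityMeasure μ]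

theorem tendsto_mul_charFun_sub_one (hmean : ∫ x, x ∂μ = 0) (hvar : ∫ x, x ^ 2 ∂μ = 1) (t : ℝ) :
    Tendsto (fun n : ℕ => (n : ℂ) * (charFun μ (t / Real.sqrt n) - 1)) atTop
      (𝓝 (-(t ^ 2 / 2))) := by
  have taylor := taylor_charFun_two (P := μ) (X := fun x => x) aemeasurable_id' hmean hvar
  rw [Measure.map_id'] at taylor
  have h := (tendsto_natCast_smul_of_isLittleO_sq taylor t).add_const (-((t : ℂ) ^ 2 / 2))
  rw [zero_add] at h
  refine h.congr' ?_
  filter_upwards [eventually_gt_atTop 0] with n hn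
  have n_ne : (n : ℂ) ≠ 0 := Nat.cast_ne_zero.2 hn.ne'
  have sq_eq : (((t / Real.sqrt n : ℝ) : ℂ)) ^ 2 = t ^ 2 / n := by
    rw [← Complex.ofReal_pow, div_pow, Real.sq_sqrt n.cast_nonneg]
    push_cast
    rfl
  rw [Complex.real_smul, sq_eq, Complex.ofReal_natCast]
  field_simp
  ring

theorem deriv_charFun_zero (hL1 : Integrable (fun x : ℝ => x) μ) :
    deriv (charFun μ) 0 = Complex.I * (∫ x, x ∂μ : ℝ) := by
  have h := iteratedDeriv_charFun_zero (μ := μ) (n := 1)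
    (by simpa [Function.id_def] using memLp_one_iff_integrable.2 hL1)
  simpa using h

theorem hasDerivAt_deriv_charFun_zero (hL2 : MemLp (fun x : ℝ => x) 2 μ) :
    HasDerivAt (deriv (charFun μ)) (-(∫ x, x ^ 2 ∂μ : ℝ)) 0 := by
  have smooth : ContDiff ℝ 1 (deriv (charFun μ)) :=
    (contDiff_succ_iff_deriv (n := 1).1 (contDiff_charFun (n := 2) hL2)).2.2
  have second_deriv := iteratedDeriv_charFun_zero (n := 2) (μ := μ) hL2
  rw [iteratedDeriv_succ, iteratedDeriv_one, Complex.I_sq, neg_one_mul] at second_deriv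
  exact second_deriv ▸ (smooth.differentiable one_ne_zero 0).hasDerivAt

theorem tendsto_sqrt_mul_deriv_charFun (hL2 : MemLp (fun x : ℝ => x) 2 μ)
    (hmean : ∫ x, x ∂μ = 0) (hvar : ∫ x, x ^ 2 ∂μ = 1) (t : ℝ) :
    Tendsto (fun n : ℕ => (Real.sqrt n : ℂ) * deriv (charFun μ) (t / Real.sqrt n)) atTop
      (𝓝 (-t)) := by
  have h := tendsto_sqrt_smul_sub_of_hasDerivAt (hasDerivAt_deriv_charFun_zero hL2) t
  rw [deriv_charFun_zero (hL2.integrable one_le_two), hmean, hvar] at h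
  simpa using h

end CharFun

/-! ### Products over pairs -/

section Pairs

theorem sym2_inf_lt_sup {α : Type*} [LinearOrder α] {s : Sym2 α} (hs : ¬s.IsDiag) :
    s.inf < s.sup := by
  induction s with | _ a b
  exact inf_lt_sup.2 hs

/-- The pairs `j < k` correspond to the unordered pairs of distinct elements. -/
def pairsEquivSym2 (n : ℕ) : Pairs n ≃ {s : Sym2 (Fin n) // ¬s.IsDiag} where
  toFun e := ⟨s(e.1.1, e.1.2), e.2.ne⟩
  invFun s := ⟨(s.1.inf, s.1.sup), sym2_inf_lt_sup s.2⟩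
  left_inv e := Subtype.ext (Prod.ext (inf_eq_left.2 e.2.le) (sup_eq_right.2 e.2.le))
  right_inv s := Subtype.ext (Sym2.sortEquiv.symm_apply_apply s.1)

variable {n : ℕ} {M : Type*} [CommMonoid M]

theorem prod_pairs_eq_prod_sym2 {F : Fin n → Fin n → M} (hF : ∀ j k, F j k = F k j) :
    ∏ e : Pairs n, F e.1.1 e.1.2 =
      ∏ s : {s : Sym2 (Fin n) // ¬s.IsDiag}, Sym2.lift ⟨F, hF⟩ s.1 :=
  (pairsEquivSym2 n).prod_comp fun s => Sym2.lift ⟨F, hF⟩ s.1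

theorem prod_pairs_comp_perm {F : Fin n → Fin n → M} (hF : ∀ j k, F j k = F k j)
    (σ : Equiv.Perm (Fin n)) :
    ∏ e : Pairs n, F (σ e.1.1) (σ e.1.2) = ∏ e : Pairs n, F e.1.1 e.1.2 := by
  rw [prod_pairs_eq_prod_sym2 hF, prod_pairs_eq_prod_sym2 fun j k => hF (σ j) (σ k)]
  let σ₂ : Equiv.Perm (Sym2 (Fin n)) :=
    { toFun := Sym2.map σ
      invFun := Sym2.map σ.symm
      left_inv := fun s => by simp [Sym2.map_map]
      right_inv := fun s => by simp [Sym2.map_map] }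
  have isDiag_iff (s : Sym2 (Fin n)) : ¬s.IsDiag ↔ ¬(σ₂ s).IsDiag := by
    induction s with | _ j k
    simp [σ₂]
  rw [← (σ₂.subtypeEquiv isDiag_iff).prod_comp fun s => Sym2.lift ⟨F, hF⟩ s.1]
  refine Finset.prod_congr rfl fun s _ => ?_
  obtain ⟨s, hs⟩ := s
  induction s
  rfl

theorem two_mul_card_pairs (n : ℕ) : 2 * Fintype.card (Pairs n) = n * (n - 1) := by
  rw [Fintype.card_congr (pairsEquivSym2 n), Sym2.card_subtype_not_diag, Fintype.card_fin,
    Nat.choose_two_right, Nat.mul_div_cancel' (Nat.even_mul_pred_self n).two_dvd]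

theorem prod_pairs_eq_prod_prod_Ioi (F : Fin n → Fin n → M) :
    ∏ e : Pairs n, F e.1.1 e.1.2 = ∏ i, ∏ j ∈ Finset.Ioi i, F i j := by
  rw [← Finset.prod_subtype (Finset.univ.filter fun e : Fin n × Fin n => e.1 < e.2) (by simp)
    fun e => F e.1 e.2, Finset.prod_filter, Fintype.prod_prod_type]
  refine Finset.prod_congr rfl fun i _ => ?_
  rw [← Finset.prod_filter, Finset.filter_lt_eq_Ioi]

theorem prod_pairs_succ (F : Fin (n + 1) → Fin (n + 1) → M) :
    ∏ e : Pairs (n + 1), F e.1.1 e.1.2 =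
      (∏ j : Fin n, F 0 j.succ) * ∏ e : Pairs n, F e.1.1.succ e.1.2.succ := by
  simp only [prod_pairs_eq_prod_prod_Ioi, prod_pairs_eq_prod_prod_Ioi fun j k => F j.succ k.succ,
    Fin.prod_univ_succ, Fin.prod_Ioi_zero, Fin.prod_Ioi_succ]

theorem prod_pairs_crossing {F : Fin n → Fin n → M} (hF : ∀ j k, F j k = F k j)
    {S : Finset (Fin n)} (hS : ∀ j k, (j ∈ S ↔ k ∈ S) → F j k = 1) :
    ∏ e : Pairs n, F e.1.1 e.1.2 = ∏ j ∈ S, ∏ k, F j k := by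
  let G (k j : Fin n) : M := if j ∈ S then F j k else 1
  have F_eq (j k : Fin n) : F j k = G k j * G j k := by
    by_cases hj : j ∈ S <;> by_cases hk : k ∈ S <;> simp [G, hj, hk, hS j k, hS k j, hF j k]
  have G_self (j : Fin n) : G j j = 1 := by simp only [G, hS j j Iff.rfl, ite_self]
  calc ∏ e : Pairs n, F e.1.1 e.1.2
    _ = ∏ j, ∏ k ∈ Finset.Ioi j, G k j * G j k := by
      rw [prod_pairs_eq_prod_prod_Ioi F]
      simp only [F_eq]
    _ = ∏ j, ∏ k ∈ {j}ᶜ, G k j := Finset.prod_prod_Ioi_mul_eq_prod_prod_off_diag G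
    _ = ∏ j, ∏ k, G k j :=
      Finset.prod_congr rfl fun j _ => by rw [Fintype.prod_eq_mul_prod_compl j, G_self, one_mul]
    _ = ∏ j ∈ S, ∏ k, F j k := by
      simp only [G, Finset.prod_ite_irrel, Finset.prod_const_one, Fintype.prod_ite_mem]

end Pairs

section MarkedPair

theorem sum_fun_fin_succ {m : ℕ} {A R : Type*} [Fintype A] [AddCommMonoid R]
    (f : (Fin (m + 1) → A) → R) :
    ∑ q, f q = ∑ c, ∑ b : Fin m → A, f (Fin.cons c b) := by
  rw [← (Fin.consEquiv fun _ => A).sum_comp, Fintype.sum_prod_type]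
  rfl

variable {m : ℕ} {A R : Type*} [CommSemiring R]

/-- In a system of spins with values in `A`, the weight of the configuration `q` when the pair
`{i, k}` is marked: the sites carry weights `v` and the pairs interactions `F`, except that the
marked sites carry `u` and the marked pair carries `G`. -/
def markedWeight (u v : A → R) (G F : A → A → R) (i k : Fin m) (q : Fin m → A) : R :=
  (∏ j, if j = i ∨ j = k then u (q j) else v (q j)) *
    ∏ e : Pairs m, if s(e.1.1, e.1.2) = s(i, k) then G (q e.1.1) (q e.1.2)
      else F (q e.1.1) (q e.1.2)

theorem markedWeight_comp_perm {u v : A → R} {G F : A → A → R} (hG : ∀ a b, G a b = G b a)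
    (hF : ∀ a b, F a b = F b a) (i k : Fin m) (q : Fin m → A) (σ : Equiv.Perm (Fin m)) :
    markedWeight u v G F i k (q ∘ σ) = markedWeight u v G F (σ i) (σ k) q := by
  unfold markedWeight
  congr 1
  · rw [← Equiv.prod_comp σ fun j => if j = σ i ∨ j = σ k then u (q j) else v (q j)]
    simp only [Function.comp_apply, EmbeddingLike.apply_eq_iff_eq]
  · rw [← prod_pairs_comp_perm (F := fun j l => if s(j, l) = s(σ i, σ k) then G (q j) (q l)
      else F (q j) (q l)) (fun j l => by simp only [Sym2.eq_swap, hG, hF]) σ]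
    simp only [Function.comp_apply, Sym2.eq_iff, EmbeddingLike.apply_eq_iff_eq]

theorem sum_markedWeight_eq [Fintype A] {u v : A → R} {G F : A → A → R}
    (hG : ∀ a b, G a b = G b a)
    (hF : ∀ a b, F a b = F b a) {i k i' k' : Fin m} (hik : i ≠ k) (hik' : i' ≠ k') :
    ∑ q, markedWeight u v G F i k q = ∑ q, markedWeight u v G F i' k' q := by
  obtain ⟨σ, rfl, rfl⟩ : ∃ σ : Equiv.Perm (Fin m), σ i = i' ∧ σ k = k' :=
    MulAction.is_two_pretransitive_iff.1 (Equiv.Perm.isMultiplyPretransitive (Fin m) 2) hik hik'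
  simp only [← markedWeight_comp_perm hG hF]
  exact ((σ.symm.arrowCongr (Equiv.refl A)).sum_comp _).symm

theorem sum_markedWeight_zero_one [Fintype A] (u v : A → R) (G F : A → A → R) :
    ∑ q, markedWeight u v G F (0 : Fin (m + 2)) 1 q =
      ∑ c₁, ∑ c₂, u c₁ * u c₂ * G c₁ c₂ * ∑ b : Fin m → A,
        (∏ j, v (b j) * (F c₁ (b j) * F c₂ (b j))) * ∏ e : Pairs m, F (b e.1.1) (b e.1.2) := by
  simp only [sum_fun_fin_succ, Finset.mul_sum]
  refine Finset.sum_congr rfl fun c₁ _ => Finset.sum_congr rfl fun c₂ _ =>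
    Finset.sum_congr rfl fun b _ => ?_
  let q : Fin (m + 2) → A := Fin.cons c₁ (Fin.cons c₂ b)
  have prod_interactions := prod_pairs_succ fun j k : Fin (m + 2) =>
    if s(j, k) = s(0, 1) then G (q j) (q k) else F (q j) (q k)
  have prod_tail := prod_pairs_succ fun j k : Fin (m + 1) =>
    if s(j.succ, k.succ) = s(0, 1) then G (q j.succ) (q k.succ) else F (q j.succ) (q k.succ)
  have succ_succ_ne_one (j : Fin m) : j.succ.succ ≠ 1 := (Fin.succ_injective _).ne j.succ_ne_zero
  simp only [markedWeight]
  rw [prod_interactions, prod_tail]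
  simp only [Fin.prod_univ_succ, zero_ne_one, or_false, ↓reduceIte, Fin.cons_zero,
    Fin.succ_ne_zero, false_or, Fin.cons_succ, Fin.succ_zero_eq_one, succ_succ_ne_one, Sym2.eq,
    Sym2.rel_iff', Prod.mk.injEq, true_and, Prod.swap_prod_mk, and_self, one_ne_zero, and_false,
    or_self, Fin.cons_one, Finset.prod_mul_distrib, q]
  ring

end MarkedPair

/-! ### Mean-field limits -/

section MeanField

theorem norm_prod_sub_prod_le {ι R : Type*} [NormedCommRing R] [NormOneClass R] (s : Finset ι)
    {x y : ι → R} (hx : ∀ i ∈ s, ‖x i‖ ≤ 1) (hy : ∀ i ∈ s, ‖y i‖ ≤ 1) :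
    ‖∏ i ∈ s, x i - ∏ i ∈ s, y i‖ ≤ ∑ i ∈ s, ‖x i - y i‖ := by
  classical
  induction s using Finset.induction_on with
  | empty => simp
  | insert a s ha ih =>
    rw [Finset.forall_mem_insert] at hx hy
    have prod_le_one : ‖∏ i ∈ s, x i‖ ≤ 1 :=
      (s.norm_prod_le x).trans (Finset.prod_le_one (fun _ _ => norm_nonneg _) hx.2)
    rw [Finset.prod_insert ha, Finset.prod_insert ha, Finset.sum_insert ha]
    calc ‖x a * ∏ i ∈ s, x i - y a * ∏ i ∈ s, y i‖
      _ = ‖(x a - y a) * ∏ i ∈ s, x i + y a * (∏ i ∈ s, x i - ∏ i ∈ s, y i)‖ := by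
        congr 1
        ring
      _ ≤ ‖x a - y a‖ * ‖∏ i ∈ s, x i‖ + ‖y a‖ * ‖∏ i ∈ s, x i - ∏ i ∈ s, y i‖ :=
        norm_add_le_of_le (norm_mul_le _ _) (norm_mul_le _ _)
      _ ≤ ‖x a - y a‖ * 1 + 1 * ∑ i ∈ s, ‖x i - y i‖ := by gcongr; exacts [hy.1, ih hx.2 hy.2]
      _ = ‖x a - y a‖ + ∑ i ∈ s, ‖x i - y i‖ := by rw [mul_one, one_mul]

theorem norm_exp_neg_le_one {x : ℝ} (hx : 0 ≤ x) : ‖(Real.exp (-x) : ℂ)‖ ≤ 1 := by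
  rw [Complex.norm_real, Real.norm_of_nonneg (Real.exp_pos _).le, Real.exp_le_one_iff]
  linarith

theorem norm_one_sub_exp_neg_le {x : ℝ} (hx : 0 ≤ x) : ‖1 - (Real.exp (-x) : ℂ)‖ ≤ x := by
  rw [← Complex.ofReal_one, ← Complex.ofReal_sub, Complex.norm_real, Real.norm_of_nonneg]
  · linarith [Real.add_one_le_exp (-x)]
  · linarith [Real.exp_le_one_iff.2 (neg_nonpos.2 hx)]

variable {m : ℕ}

theorem exp_neg_pow_card (g : ℝ) (S : Finset (Fin m)) :
    (Real.exp (-g) : ℂ) ^ S.card = ∏ _j ∈ S, ∏ _k : Fin m, (Real.exp (-(g / m)) : ℂ) := by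
  rw [← Finset.prod_const]
  refine Finset.prod_congr rfl fun j _ => ?_
  have m_ne : (m : ℝ) ≠ 0 := Nat.cast_ne_zero.2 j.pos.ne'
  rw [Finset.prod_const, Finset.card_fin, ← Complex.ofReal_pow, ← Real.exp_nat_mul, mul_neg,
    mul_div_cancel₀ _ m_ne]

theorem norm_prod_pairs_sub_le {F : Fin m → Fin m → ℂ} (hsymm : ∀ j k, F j k = F k j)
    (hF : ∀ j k, ‖F j k‖ ≤ 1) {S : Finset (Fin m)} (hS : ∀ j k, (j ∈ S ↔ k ∈ S) → F j k = 1)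
    {g δ : ℝ} (hg : 0 ≤ g) (hδ : 0 ≤ δ)
    (hcross : ∀ j ∈ S, ∀ k ∉ S, ‖F j k - Real.exp (-(g / m))‖ ≤ δ) :
    ‖∏ e : Pairs m, F e.1.1 e.1.2 - (Real.exp (-g) : ℂ) ^ S.card‖ ≤
      (m * δ + g / m) * 4 ^ S.card := by
  have hgm : 0 ≤ g / m := by positivity
  have row_bound (j : Fin m) (hj : j ∈ S) :
      ∑ k, ‖F j k - Real.exp (-(g / m))‖ ≤ m * δ + S.card * (g / m) := by
    calc ∑ k, ‖F j k - Real.exp (-(g / m))‖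
      _ ≤ ∑ k, (δ + if k ∈ S then g / m else 0) := by
        refine Finset.sum_le_sum fun k _ => ?_
        by_cases hk : k ∈ S
        · rw [hS j k (iff_of_true hj hk), if_pos hk]
          exact (norm_one_sub_exp_neg_le hgm).trans (le_add_of_nonneg_left hδ)
        · rw [if_neg hk, add_zero]
          exact hcross j hj k hk
      _ = m * δ + S.card * (g / m) := by simp [Finset.sum_add_distrib]
  have card_le : (S.card : ℝ) ≤ S.card ^ 2 := mod_cast Nat.le_self_pow two_ne_zero _
  have card_sq_le : (S.card : ℝ) ^ 2 ≤ 4 ^ S.card := by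
    calc (S.card : ℝ) ^ 2
      _ ≤ (2 ^ S.card) ^ 2 := by gcongr; exact_mod_cast Nat.lt_two_pow_self.le
      _ = 4 ^ S.card := by rw [← pow_mul, mul_comm, pow_mul]; norm_num
  rw [prod_pairs_crossing hsymm hS, exp_neg_pow_card, ← Finset.prod_product',
    ← Finset.prod_product' (f := fun _ _ => (Real.exp (-(g / m)) : ℂ))]
  calc _ ≤ ∑ p ∈ S ×ˢ Finset.univ, ‖F p.1 p.2 - Real.exp (-(g / m))‖ :=
        norm_prod_sub_prod_le _ (fun p _ => hF _ _) fun _ _ => norm_exp_neg_le_one hgm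
    _ = ∑ j ∈ S, ∑ k, ‖F j k - Real.exp (-(g / m))‖ :=
      Finset.sum_product' _ _ fun j k => ‖F j k - Real.exp (-(g / m))‖
    _ ≤ S.card * (m * δ + S.card * (g / m)) :=
      (Finset.sum_le_card_nsmul S _ _ row_bound).trans_eq (nsmul_eq_mul _ _)
    _ = S.card * (m * δ) + S.card ^ 2 * (g / m) := by ring
    _ ≤ 4 ^ S.card * (m * δ) + 4 ^ S.card * (g / m) := by
      gcongr
      exact card_le.trans card_sq_le
    _ = (m * δ + g / m) * 4 ^ S.card := by ring

variable {A : Type*} (D : A → Prop) [DecidablePred D]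

/-- The factor `r` for the sites outside the set `D` of inert states. -/
def damping (r : ℝ) (a : A) : ℝ := if D a then 1 else r

theorem damping_nonneg {r : ℝ} (hr : 0 ≤ r) (a : A) : 0 ≤ damping D r a := by
  unfold damping
  split_ifs <;> positivity

theorem prod_damping (r : ℝ) (b : Fin m → A) :
    ∏ j, damping D r (b j) = r ^ (Finset.univ.filter fun j => ¬D (b j)).card := by
  simp [damping, Finset.prod_ite]

variable [Fintype A] {D}

theorem norm_sum_prod_pairs_sub_pow_le {f : A → A → ℂ} (hsymm : ∀ a b, f a b = f b a)
    (hf : ∀ a b, ‖f a b‖ ≤ 1) (hone : ∀ a b, (D a ↔ D b) → f a b = 1) {g δ : ℝ} (hg : 0 ≤ g)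
    (hδ : 0 ≤ δ) (hcross : ∀ a b, ¬D a → D b → ‖f a b - Real.exp (-(g / m))‖ ≤ δ) (w : A → ℂ) :
    ‖∑ b : Fin m → A, (∏ j, w (b j)) * ∏ e : Pairs m, f (b e.1.1) (b e.1.2) -
        (∑ a, w a * damping D (Real.exp (-g)) a) ^ m‖ ≤
      (m * δ + g / m) * (∑ a, ‖w a‖ * damping D 4 a) ^ m := by
  have interaction_bound (b : Fin m → A) :
      ‖∏ e : Pairs m, f (b e.1.1) (b e.1.2) - ∏ j, (damping D (Real.exp (-g)) (b j) : ℂ)‖ ≤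
        (m * δ + g / m) * ∏ j, damping D 4 (b j) := by
    rw [← Complex.ofReal_prod, prod_damping, prod_damping, Complex.ofReal_pow]
    refine norm_prod_pairs_sub_le (F := fun j k => f (b j) (b k)) (fun j k => hsymm _ _)
      (fun j k => hf _ _) (fun j k h => hone _ _ ?_) hg hδ fun j hj k hk => hcross _ _ ?_ ?_
    · simpa [not_iff_not] using h
    · simpa using hj
    · simpa using hk
  rw [Fintype.sum_pow, Fintype.sum_pow, ← Finset.sum_sub_distrib, Finset.mul_sum]
  refine (norm_sum_le _ _).trans (Finset.sum_le_sum fun b _ => ?_)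
  rw [Finset.prod_mul_distrib, Finset.prod_mul_distrib, ← mul_sub, norm_mul, norm_prod,
    mul_left_comm]
  exact mul_le_mul_of_nonneg_left (interaction_bound b) (by positivity)

variable {w : ℕ → A → ℂ} {w₀ : A → ℝ} {κ : A → ℂ}

theorem sum_mul_damping (hw₀ : ∀ a, ¬D a → w₀ a = 0) (r : ℝ) :
    ∑ a, w₀ a * damping D r a = ∑ a, w₀ a := by
  refine Finset.sum_congr rfl fun a _ => ?_
  by_cases ha : D a
  · rw [damping, if_pos ha, mul_one]
  · rw [hw₀ a ha, zero_mul]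

theorem tendsto_sum_mul_damping_pow (hw₀ : ∀ a, ¬D a → w₀ a = 0) (hsum : ∑ a, w₀ a = 1)
    (hw : ∀ a, Tendsto (fun m : ℕ => (m : ℂ) * (w m a - w₀ a)) atTop (𝓝 (κ a))) (r : ℝ) :
    Tendsto (fun m : ℕ => (∑ a, w m a * damping D r a) ^ m) atTop
      (𝓝 (Complex.exp (∑ a, κ a * damping D r a))) := by
  have sum_w₀ : ∑ a, (w₀ a : ℂ) * damping D r a = 1 := by
    exact_mod_cast (sum_mul_damping hw₀ r).trans hsum
  have h := Complex.tendsto_one_add_pow_exp_of_tendsto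
    (g := fun m => ∑ a, (w m a - w₀ a) * damping D r a) (t := ∑ a, κ a * damping D r a) ?_
  · refine h.congr fun m => ?_
    simp only [sub_mul, Finset.sum_sub_distrib, sum_w₀, add_sub_cancel]
  · simp only [Finset.mul_sum, ← mul_assoc]
    exact tendsto_finsetSum _ fun a _ => (hw a).mul_const _

theorem exists_eventually_sum_norm_mul_damping_pow_le (hw₀ : ∀ a, ¬D a → w₀ a = 0)
    (hw₀_nonneg : ∀ a, 0 ≤ w₀ a) (hsum : ∑ a, w₀ a = 1)
    (hw : ∀ a, Tendsto (fun m : ℕ => (m : ℂ) * (w m a - w₀ a)) atTop (𝓝 (κ a))) {r : ℝ}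
    (hr : 0 ≤ r) :
    ∃ K, ∀ᶠ m : ℕ in atTop, (∑ a, ‖w m a‖ * damping D r a) ^ m ≤ K := by
  have h := Real.tendsto_one_add_pow_exp_of_tendsto
    (g := fun m => ∑ a, ‖w m a - w₀ a‖ * damping D r a) (t := ∑ a, ‖κ a‖ * damping D r a) ?_
  · refine ⟨_, (h.eventually_le_const (lt_add_one _)).mono fun m hm => le_trans ?_ hm⟩
    have norm_le (a : A) : ‖w m a‖ ≤ w₀ a + ‖w m a - w₀ a‖ := by
      simpa [abs_of_nonneg (hw₀_nonneg a)] using norm_add_le (w₀ a : ℂ) (w m a - w₀ a)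
    have damping_nonneg := damping_nonneg D hr
    rw [← hsum, ← sum_mul_damping hw₀ r, ← Finset.sum_add_distrib]
    simp only [← add_mul]
    gcongr with a
    exacts [Finset.sum_nonneg fun a _ => mul_nonneg (norm_nonneg _) (damping_nonneg a),
      damping_nonneg a, norm_le a]
  · simp only [Finset.mul_sum, ← mul_assoc]
    refine tendsto_finsetSum _ fun a _ => ((hw a).norm.congr fun m => ?_).mul_const _
    rw [norm_mul, RCLike.norm_natCast]

theorem tendsto_natCast_mul_exp_neg_div_sub_one (g : ℝ) :
    Tendsto (fun m : ℕ => (m : ℂ) * ((Real.exp (-(g / m)) : ℂ) - 1)) atTop (𝓝 (-g)) := by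
  have deriv_exp : HasDerivAt (fun s : ℝ => Real.exp (-(g * s))) (-g) 0 := by
    simpa using (((hasDerivAt_id (0 : ℝ)).const_mul g).neg).exp
  have h := (Complex.continuous_ofReal.tendsto _).comp (deriv_exp.tendsto_slope_zero_right.comp
    (tendsto_inv_atTop_nhdsGT_zero.comp (tendsto_natCast_atTop_atTop (R := ℝ))))
  rw [Complex.ofReal_neg] at h
  exact h.congr fun m => by simp [div_eq_mul_inv]

theorem exists_cross_bound {A : Type*} [Finite A] {D : A → Prop} {f : ℕ → A → A → ℂ} {g : ℝ}
    (hcross : ∀ a b, ¬D a → D b →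
      Tendsto (fun m : ℕ => (m : ℂ) * (f m a b - 1)) atTop (𝓝 (-g))) :
    ∃ δ : ℕ → ℝ, (∀ m, 0 ≤ δ m) ∧
      (∀ m a b, ¬D a → D b → ‖f m a b - Real.exp (-(g / m))‖ ≤ δ m) ∧
      Tendsto (fun m : ℕ => m * δ m) atTop (𝓝 0) := by
  classical
  cases nonempty_fintype A
  let ε (m : ℕ) (p : A × A) : ℝ :=
    if ¬D p.1 ∧ D p.2 then ‖f m p.1 p.2 - Real.exp (-(g / m))‖ else 0
  have ε_nonneg (m : ℕ) (p : A × A) : 0 ≤ ε m p := by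
    unfold ε
    split_ifs <;> positivity
  refine ⟨fun m => ∑ p, ε m p, fun m => Finset.sum_nonneg fun p _ => ε_nonneg m p,
    fun m a b ha hb => ?_, ?_⟩
  · have h := Finset.single_le_sum (fun p _ => ε_nonneg m p) (Finset.mem_univ (a, b))
    simpa [ε, ha, hb] using h
  · simp only [Finset.mul_sum]
    rw [← Finset.sum_const_zero]
    refine tendsto_finsetSum _ fun p _ => ?_
    by_cases hp : ¬D p.1 ∧ D p.2
    · have h := ((hcross p.1 p.2 hp.1 hp.2).sub (tendsto_natCast_mul_exp_neg_div_sub_one g)).norm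
      rw [sub_self, norm_zero] at h
      refine h.congr fun m => ?_
      rw [← mul_sub, sub_sub_sub_cancel_right, norm_mul, RCLike.norm_natCast]
      simp only [ε, if_pos hp]
    · simp only [ε, if_neg hp, mul_zero, tendsto_const_nhds]

/-- A site is outside `D` with weight `O(1/m)`, so only boundedly many sites are. Each of them
interacts with the `m - O(1)` sites in `D`, and picks up `(1 - g/m) ^ m ≈ exp (-g)` in total. -/
theorem tendsto_sum_prod_pairs {f : ℕ → A → A → ℂ} (hsymm : ∀ m a b, f m a b = f m b a)
    (hf : ∀ m a b, ‖f m a b‖ ≤ 1) (hone : ∀ m a b, (D a ↔ D b) → f m a b = 1) {g : ℝ}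
    (hg : 0 ≤ g)
    (hcross : ∀ a b, ¬D a → D b →
      Tendsto (fun m : ℕ => (m : ℂ) * (f m a b - 1)) atTop (𝓝 (-g)))
    (hw₀ : ∀ a, ¬D a → w₀ a = 0) (hw₀_nonneg : ∀ a, 0 ≤ w₀ a) (hsum : ∑ a, w₀ a = 1)
    (hw : ∀ a, Tendsto (fun m : ℕ => (m : ℂ) * (w m a - w₀ a)) atTop (𝓝 (κ a))) :
    Tendsto (fun m : ℕ => ∑ b : Fin m → A,
        (∏ j, w m (b j)) * ∏ e : Pairs m, f m (b e.1.1) (b e.1.2)) atTop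
      (𝓝 (Complex.exp (∑ a, κ a * damping D (Real.exp (-g)) a))) := by
  obtain ⟨δ, δ_nonneg, cross_le, tendsto_δ⟩ := exists_cross_bound hcross
  obtain ⟨K, eventually_le_K⟩ := exists_eventually_sum_norm_mul_damping_pow_le hw₀ hw₀_nonneg
    hsum hw (r := 4) (by norm_num)
  have error_tendsto : Tendsto (fun m : ℕ => (m * δ m + g / m) * K) atTop (𝓝 0) := by
    simpa using (tendsto_δ.add (tendsto_const_div_atTop_nhds_zero_nat g)).mul_const K
  have difference_tendsto := squeeze_zero_norm' (eventually_le_K.mono fun m hm =>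
    (norm_sum_prod_pairs_sub_pow_le (hsymm m) (hf m) (hone m) hg (δ_nonneg m) (cross_le m)
      (w m)).trans (mul_le_mul_of_nonneg_left hm (by have := δ_nonneg m; positivity)))
    error_tendsto
  simpa using difference_tendsto.add (tendsto_sum_mul_damping_pow hw₀ hsum hw (Real.exp (-g)))

end MeanField

/-! ### The unmeasured qubits -/

section BulkWeight

/-- The ket and bra spins of the qubit agree, as for a classical spin. -/
abbrev IsClassical (b : KetBra) : Prop := b.1 = b.2

theorem sum_mixTransfer (β : ℝ) (c : KetBra) :
    ∑ z, mixTransfer β (z, z) c = if IsClassical c then 1 else 0 := by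
  obtain ⟨a, b⟩ := c
  rw [sum_units _ a]
  rcases eq_or_eq_neg_units b a with rfl | rfl
  · simp only [mixTransfer, mixKernel_self, mixKernel_neg_left, map_neg, map_mul, Complex.conj_I,
      Complex.conj_ofReal, if_true]
    push_cast
    linear_combination Complex.cos_sq_add_sin_sq (β : ℂ) - Complex.sin β ^ 2 * Complex.I_sq
  · simp only [mixTransfer, mixKernel_self, mixKernel_neg_left, mixKernel_neg_right, map_neg,
      map_mul, Complex.conj_I, Complex.conj_ofReal, if_neg (units_ne_neg_self a)]
    ring

variable (γ₁ γ₂ β₁ β₂ : ℝ)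

theorem bulkWeight_eq (q : SpinPath) :
    bulkWeight β₁ β₂ q =
      if IsClassical q.2 then mixTransfer β₁ q.2 q.1 * (1 / 2) else 0 := by
  simp only [bulkWeight, pathAmp, ← Finset.sum_mul, sum_mixTransfer, ite_mul, one_mul, zero_mul]

theorem sum_bulkWeight_mul (h : SpinPath → ℂ) :
    ∑ q, bulkWeight β₁ β₂ q * h q =
      ∑ b, ∑ z, mixTransfer β₁ (z, z) b * (1 / 2) * h (b, (z, z)) := by
  simp only [bulkWeight_eq, IsClassical, Fintype.sum_prod_type, ite_mul, zero_mul,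
    Finset.sum_ite_eq, Finset.mem_univ, if_true]

theorem sum_bulkWeight (b : KetBra) :
    ∑ c, bulkWeight β₁ β₂ (b, c) = if IsClassical b then 1 / 2 else 0 := by
  simp only [bulkWeight_eq, IsClassical, Fintype.sum_prod_type, Finset.sum_ite_eq, Finset.mem_univ,
    if_true, ← Finset.sum_mul, sum_mixTransfer, ite_mul, one_mul, zero_mul]

theorem layerPhase_comm (γ : ℝ) (b c : KetBra) : layerPhase γ b c = layerPhase γ c b := by
  simp only [layerPhase, mul_comm]

theorem phase_comm (p q : SpinPath) : phase γ₁ γ₂ p q = phase γ₁ γ₂ q p := by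
  rw [phase, phase, layerPhase_comm, layerPhase_comm γ₂]

theorem layerPhase_eq_zero (γ : ℝ) {b c : KetBra} (h : IsClassical b ↔ IsClassical c) :
    layerPhase γ b c = 0 := by
  by_cases hb : IsClassical b
  · rw [layerPhase, hb, h.1 hb, sub_self, mul_zero]
  · have hc := mt h.2 hb
    rw [layerPhase, (eq_or_eq_neg_units b.1 b.2).resolve_left hb,
      (eq_or_eq_neg_units c.1 c.2).resolve_left hc, spinVal_neg, spinVal_neg]
    ring

theorem layerPhase_sq (γ : ℝ) {b c : KetBra} (hb : ¬IsClassical b) (hc : IsClassical c) :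
    layerPhase γ b c ^ 2 = 4 * γ ^ 2 := by
  rw [layerPhase, (eq_or_eq_neg_units b.1 b.2).resolve_left hb, hc, spinVal_neg]
  linear_combination
    4 * γ ^ 2 * (spinVal c.2 ^ 2 * spinVal_mul_self b.2 + spinVal_mul_self c.2)

end BulkWeight

section BulkSum

variable (μ : Measure ℝ) (γ₁ γ₂ β₁ β₂ : ℝ)

/-- The averaged weight of a configuration of `m` unmeasured qubits, summed over configurations,
when the two measured qubits have the histories `c₁` and `c₂`. -/
noncomputable def bulkSum (m : ℕ) (c₁ c₂ : SpinPath) : ℂ :=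
  ∑ q : Fin m → SpinPath,
    (∏ j, bulkWeight β₁ β₂ (q j) * (charFun μ (phase γ₁ γ₂ c₁ (q j) / Real.sqrt (m + 2 : ℕ)) *
      charFun μ (phase γ₁ γ₂ c₂ (q j) / Real.sqrt (m + 2 : ℕ)))) *
    ∏ e : Pairs m, charFun μ (phase γ₁ γ₂ (q e.1.1) (q e.1.2) / Real.sqrt (m + 2 : ℕ))

/-- The weight of the first-layer spins of an unmeasured qubit in `bulkSum`. -/
noncomputable def firstLayerWeight (m : ℕ) (c₁ c₂ : SpinPath) (b : KetBra) : ℂ :=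
  ∑ c, bulkWeight β₁ β₂ (b, c) * (charFun μ (phase γ₁ γ₂ c₁ (b, c) / Real.sqrt (m + 2 : ℕ)) *
    charFun μ (phase γ₁ γ₂ c₂ (b, c) / Real.sqrt (m + 2 : ℕ)))

theorem bulkSum_eq (m : ℕ) (c₁ c₂ : SpinPath) :
    bulkSum μ γ₁ γ₂ β₁ β₂ m c₁ c₂ = ∑ b : Fin m → KetBra,
      (∏ j, firstLayerWeight μ γ₁ γ₂ β₁ β₂ m c₁ c₂ (b j)) *
        ∏ e : Pairs m, charFun μ (layerPhase γ₁ (b e.1.1) (b e.1.2) / Real.sqrt (m + 2 : ℕ)) := by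
  have factor_eq (q : Fin m → SpinPath) (u : SpinPath → ℂ) :
      (∏ j, bulkWeight β₁ β₂ (q j) * u (q j)) *
        ∏ e : Pairs m, charFun μ (phase γ₁ γ₂ (q e.1.1) (q e.1.2) / Real.sqrt (m + 2 : ℕ)) =
      (∏ j, bulkWeight β₁ β₂ (q j) * u (q j)) *
        ∏ e : Pairs m,
          charFun μ (layerPhase γ₁ (q e.1.1).1 (q e.1.2).1 / Real.sqrt (m + 2 : ℕ)) := by
    by_cases all_classical : ∀ j, IsClassical (q j).2
    · simp only [phase, layerPhase_eq_zero γ₂ (iff_of_true (all_classical _) (all_classical _)),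
        add_zero]
    · obtain ⟨j, not_classical⟩ := not_forall.1 all_classical
      have prod_eq_zero : ∏ j, bulkWeight β₁ β₂ (q j) * u (q j) = 0 :=
        Finset.prod_eq_zero (Finset.mem_univ j)
          (by rw [bulkWeight_eq, if_neg not_classical, zero_mul])
      rw [prod_eq_zero, zero_mul, zero_mul]
  simp only [firstLayerWeight, Fintype.prod_sum, Finset.sum_mul]
  rw [← sum_prodMk_eq]
  exact Finset.sum_congr rfl fun q _ => factor_eq q fun p =>
    charFun μ (phase γ₁ γ₂ c₁ p / Real.sqrt (m + 2 : ℕ)) *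
      charFun μ (phase γ₁ γ₂ c₂ p / Real.sqrt (m + 2 : ℕ))

/-- The exponent by which the unmeasured qubits act on a measured qubit with history `c`. -/
noncomputable def pathExponent (c : SpinPath) : ℂ :=
  ∑ q, bulkWeight β₁ β₂ q * (damping IsClassical (Real.exp (-(2 * γ₁ ^ 2))) q.1 *
    -(phase γ₁ γ₂ c q ^ 2 / 2))

variable [IsProbabilityMeasure μ] {μ}

theorem tendsto_firstLayerWeight (hmean : ∫ x, x ∂μ = 0) (hvar : ∫ x, x ^ 2 ∂μ = 1)
    (c₁ c₂ : SpinPath) (b : KetBra) :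
    Tendsto (fun m : ℕ => (m : ℂ) * (firstLayerWeight μ γ₁ γ₂ β₁ β₂ m c₁ c₂ b -
        ((if IsClassical b then 1 / 2 else 0 : ℝ) : ℂ))) atTop
      (𝓝 (∑ c, bulkWeight β₁ β₂ (b, c) *
        (-(phase γ₁ γ₂ c₁ (b, c) ^ 2 / 2) + -(phase γ₁ γ₂ c₂ (b, c) ^ 2 / 2)))) := by
  have h := tendsto_finsetSum Finset.univ fun c _ => (tendsto_natCast_mul_comp_add
    (tendsto_natCast_mul_mul_sub_one
      (tendsto_mul_charFun_sub_one hmean hvar (phase γ₁ γ₂ c₁ (b, c)))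
      (tendsto_mul_charFun_sub_one hmean hvar (phase γ₁ γ₂ c₂ (b, c)))) 2).const_mul
        (bulkWeight β₁ β₂ (b, c))
  refine h.congr fun m => ?_
  have weight_eq :
      ((if IsClassical b then 1 / 2 else 0 : ℝ) : ℂ) = ∑ c, bulkWeight β₁ β₂ (b, c) := by
    rw [sum_bulkWeight]
    split_ifs <;> simp
  rw [weight_eq, firstLayerWeight, ← Finset.sum_sub_distrib, Finset.mul_sum]
  exact Finset.sum_congr rfl fun c _ => by ring

theorem tendsto_bulkSum (hmean : ∫ x, x ∂μ = 0) (hvar : ∫ x, x ^ 2 ∂μ = 1) (c₁ c₂ : SpinPath) :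
    Tendsto (fun m => bulkSum μ γ₁ γ₂ β₁ β₂ m c₁ c₂) atTop
      (𝓝 (Complex.exp (pathExponent γ₁ γ₂ β₁ β₂ c₁ + pathExponent γ₁ γ₂ β₁ β₂ c₂))) := by
  simp only [bulkSum_eq]
  have h := tendsto_sum_prod_pairs (D := IsClassical) (g := 2 * γ₁ ^ 2)
    (f := fun m b c => charFun μ (layerPhase γ₁ b c / Real.sqrt (m + 2 : ℕ)))
    (w₀ := fun b => if IsClassical b then 1 / 2 else 0)
    (fun m b c => by rw [layerPhase_comm]) (fun m b c => norm_charFun_le_one _)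
    (fun m b c hbc => by rw [layerPhase_eq_zero γ₁ hbc, zero_div, charFun_zero]; simp)
    (by positivity) ?_ (fun b hb => if_neg hb) (fun b => by positivity) ?_
    (tendsto_firstLayerWeight γ₁ γ₂ β₁ β₂ hmean hvar c₁ c₂)
  · convert h using 3
    simp only [pathExponent, Finset.sum_mul, ← Finset.sum_add_distrib]
    refine (Fintype.sum_prod_type _).trans ?_
    exact Finset.sum_congr rfl fun b _ => Finset.sum_congr rfl fun c _ => by ring
  · intro b c hb hc
    convert tendsto_natCast_mul_comp_add
      (tendsto_mul_charFun_sub_one hmean hvar (layerPhase γ₁ b c)) 2 using 2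
    rw [← Complex.ofReal_pow, layerPhase_sq γ₁ hb hc]
    push_cast
    ring
  · simp only [Fintype.sum_prod_type, Finset.sum_ite_eq, Finset.mem_univ, if_true]
    simp

end BulkSum

/-! ### Evaluation of the limit -/

section Evaluation

theorem spinVal_one : spinVal 1 = 1 := by simp [spinVal]

theorem sum_ketBra {M : Type*} [AddCommMonoid M] (f : KetBra → M) :
    ∑ c, f c = ∑ z, (f (z, z) + f (z, -z)) := by
  rw [Fintype.sum_prod_type]
  exact Finset.sum_congr rfl fun z _ => sum_units _ z

theorem sum_mixTransfer_self_mul (β : ℝ) (z : ℤˣ) (h : KetBra → ℂ) :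
    ∑ b, mixTransfer β (z, z) b * h b =
      Real.cos β ^ 2 * h (z, z) + Real.sin β ^ 2 * h (-z, -z) +
        Complex.I / 2 * Real.sin (2 * β) * (h (z, -z) - h (-z, z)) := by
  simp only [sum_ketBra, sum_units _ z, neg_neg, mixTransfer, mixKernel_self, mixKernel_neg_right,
    map_neg, map_mul, Complex.conj_I, Complex.conj_ofReal, Real.sin_two_mul]
  push_cast
  linear_combination -(Complex.sin β ^ 2 * h (-z, -z)) * Complex.I_sq

theorem sum_mixTransfer_neg_mul (β : ℝ) (z : ℤˣ) (h : KetBra → ℂ) :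
    ∑ b, mixTransfer β (z, -z) b * h b =
      Real.cos β ^ 2 * h (z, -z) + Real.sin β ^ 2 * h (-z, z) +
        Complex.I / 2 * Real.sin (2 * β) * (h (z, z) - h (-z, -z)) := by
  simp only [sum_ketBra, sum_units _ z, neg_neg, mixTransfer, mixKernel_self, mixKernel_neg_right,
    mixKernel_neg_left, map_neg, map_mul, Complex.conj_I, Complex.conj_ofReal, Real.sin_two_mul]
  push_cast
  linear_combination -(Complex.sin β ^ 2 * h (-z, z)) * Complex.I_sq

theorem coreWeight_self (β₁ β₂ : ℝ) (b : KetBra) (z : ℤˣ) :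
    coreWeight β₁ β₂ (b, (z, z)) =
      Real.cos (2 * β₂) / 2 * (spinVal z * mixTransfer β₁ (z, z) b) := by
  simp only [coreWeight, pathAmp, sum_units _ z, mixTransfer, mixKernel_self, mixKernel_neg_left,
    map_neg, map_mul, Complex.conj_I, Complex.conj_ofReal, spinVal_neg, Real.cos_two_mul']
  push_cast
  linear_combination (1 / 2 * Complex.sin β₂ ^ 2 * spinVal z *
    (mixKernel β₁ z b.1 * starRingEnd ℂ (mixKernel β₁ z b.2))) * Complex.I_sq

theorem coreWeight_neg (β₁ β₂ : ℝ) (b : KetBra) (z : ℤˣ) :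
    coreWeight β₁ β₂ (b, (z, -z)) =
      Complex.I / 2 * Real.sin (2 * β₂) * (spinVal z * mixTransfer β₁ (z, -z) b) := by
  simp only [coreWeight, pathAmp, sum_units _ z, mixTransfer, mixKernel_self, mixKernel_neg_left,
    mixKernel_neg_right, map_neg, map_mul, Complex.conj_I, Complex.conj_ofReal, spinVal_neg,
    Real.sin_two_mul]
  push_cast
  ring

variable (γ₁ γ₂ β₁ β₂ : ℝ)

theorem pathExponent_eq (b c : KetBra) :
    pathExponent γ₁ γ₂ β₁ β₂ (b, c) =
      -(γ₁ ^ 2 * (1 - spinVal b.1 * spinVal b.2) + γ₂ ^ 2 * (1 - spinVal c.1 * spinVal c.2) +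
        γ₁ * γ₂ * (spinVal c.2 - spinVal c.1) *
          (Real.cos (2 * β₁) * (spinVal b.2 - spinVal b.1) -
            Complex.I * Real.sin (2 * β₁) * Real.exp (-(2 * γ₁ ^ 2)) *
              (spinVal b.2 + spinVal b.1))) := by
  rw [pathExponent, sum_bulkWeight_mul, Finset.sum_comm]
  simp only [mul_assoc (mixTransfer _ _ _), sum_mixTransfer_self_mul, sum_units _ 1, damping,
    IsClassical, if_true, if_neg (units_ne_neg_self _), if_neg (units_ne_neg_self _).symm, phase,
    layerPhase, spinVal_neg, spinVal_one, neg_neg, Real.cos_two_mul']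
  push_cast
  linear_combination
    -((γ₁ * (spinVal b.2 - spinVal b.1)) ^ 2 + (γ₂ * (spinVal c.2 - spinVal c.1)) ^ 2 : ℂ) / 2 *
      Complex.cos_sq_add_sin_sq (β₁ : ℂ) -
    γ₁ ^ 2 / 2 * (ofReal_spinVal_mul_self b.1 + ofReal_spinVal_mul_self b.2) -
      γ₂ ^ 2 / 2 * (ofReal_spinVal_mul_self c.1 + ofReal_spinVal_mul_self c.2)

/-- The weight of the history `c` of a measured qubit after averaging over all other qubits. -/
noncomputable def limitWeight (c : SpinPath) : ℂ :=
  coreWeight β₁ β₂ c * Complex.exp (pathExponent γ₁ γ₂ β₁ β₂ c)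

theorem exp_pathExponent_self_self (a z : ℤˣ) :
    Complex.exp (pathExponent γ₁ γ₂ β₁ β₂ ((a, a), (z, z))) = 1 := by
  rw [pathExponent_eq, ← Complex.ofReal_mul (spinVal a), ← Complex.ofReal_mul (spinVal z),
    spinVal_mul_self, spinVal_mul_self]
  simp

theorem exp_pathExponent_neg_self (a z : ℤˣ) :
    Complex.exp (pathExponent γ₁ γ₂ β₁ β₂ ((a, -a), (z, z))) = Real.exp (-2 * γ₁ ^ 2) := by
  rw [pathExponent_eq, Complex.ofReal_exp (-2 * γ₁ ^ 2), spinVal_neg]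
  congr 1
  push_cast
  linear_combination -(γ₁ : ℂ) ^ 2 * ofReal_spinVal_mul_self a + γ₂ ^ 2 * ofReal_spinVal_mul_self z

theorem exp_pathExponent_self_neg (a z : ℤˣ) :
    Complex.exp (pathExponent γ₁ γ₂ β₁ β₂ ((a, a), (z, -z))) =
      Real.exp (-2 * γ₂ ^ 2) * (Real.cos (Lam γ₁ γ₂ β₁) -
        spinVal z * spinVal a * Real.sin (Lam γ₁ γ₂ β₁) * Complex.I) := by
  have exp_eq : (Real.cos (Lam γ₁ γ₂ β₁) -
      spinVal z * spinVal a * Real.sin (Lam γ₁ γ₂ β₁) * Complex.I : ℂ) =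
      Complex.exp (-(spinVal z * spinVal a * Lam γ₁ γ₂ β₁ : ℝ) * Complex.I) := by
    rw [Complex.exp_mul_I, Complex.cos_neg, Complex.sin_neg, ← Complex.ofReal_cos,
      ← Complex.ofReal_sin]
    rcases Int.units_eq_one_or z with rfl | rfl <;> rcases Int.units_eq_one_or a with rfl | rfl <;>
      simp [spinVal, ← sub_eq_add_neg]
  rw [exp_eq, pathExponent_eq, Complex.ofReal_exp (-2 * γ₂ ^ 2), ← Complex.exp_add, spinVal_neg,
    Lam, neg_mul 2 (γ₁ ^ 2)]
  congr 1
  push_cast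
  linear_combination (γ₁ : ℂ) ^ 2 * ofReal_spinVal_mul_self a - γ₂ ^ 2 * ofReal_spinVal_mul_self z

theorem exp_pathExponent_neg_neg (a z : ℤˣ) :
    Complex.exp (pathExponent γ₁ γ₂ β₁ β₂ ((a, -a), (z, -z))) =
      Real.exp (-2 * (γ₁ ^ 2 + γ₂ ^ 2)) * (Real.cosh (Omg γ₁ γ₂ β₁) -
        spinVal z * spinVal a * Real.sinh (Omg γ₁ γ₂ β₁)) := by
  have exp_eq : (Real.cosh (Omg γ₁ γ₂ β₁) - spinVal z * spinVal a * Real.sinh (Omg γ₁ γ₂ β₁) : ℂ) =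
      Complex.exp (-(spinVal z * spinVal a * Omg γ₁ γ₂ β₁ : ℝ)) := by
    rw [← Complex.cosh_add_sinh, Complex.cosh_neg, Complex.sinh_neg]
    rcases Int.units_eq_one_or z with rfl | rfl <;> rcases Int.units_eq_one_or a with rfl | rfl <;>
      simp [spinVal, ← sub_eq_add_neg]
  rw [exp_eq, pathExponent_eq, Complex.ofReal_exp (-2 * (γ₁ ^ 2 + γ₂ ^ 2)), ← Complex.exp_add,
    spinVal_neg, spinVal_neg, Omg]
  congr 1
  push_cast
  linear_combination -(γ₁ : ℂ) ^ 2 * ofReal_spinVal_mul_self a - γ₂ ^ 2 * ofReal_spinVal_mul_self z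

theorem sum_limitWeight_mul (f : SpinPath → ℂ) :
    ∑ c, limitWeight γ₁ γ₂ β₁ β₂ c * f c = ∑ z, spinVal z *
      (Real.cos (2 * β₂) / 2 *
          (Real.cos β₁ ^ 2 * f ((z, z), (z, z)) + Real.sin β₁ ^ 2 * f ((-z, -z), (z, z)) +
            Complex.I / 2 * Real.sin (2 * β₁) * (Real.exp (-2 * γ₁ ^ 2) *
              (f ((z, -z), (z, z)) - f ((-z, z), (z, z))))) +
        Complex.I / 2 * Real.sin (2 * β₂) *
          (Real.exp (-2 * (γ₁ ^ 2 + γ₂ ^ 2)) *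
            (Real.cos β₁ ^ 2 * (Real.cosh (Omg γ₁ γ₂ β₁) - Real.sinh (Omg γ₁ γ₂ β₁)) *
                f ((z, -z), (z, -z)) +
              Real.sin β₁ ^ 2 * (Real.cosh (Omg γ₁ γ₂ β₁) + Real.sinh (Omg γ₁ γ₂ β₁)) *
                f ((-z, z), (z, -z))) +
            Complex.I / 2 * Real.sin (2 * β₁) * (Real.exp (-2 * γ₂ ^ 2) *
              ((Real.cos (Lam γ₁ γ₂ β₁) - Real.sin (Lam γ₁ γ₂ β₁) * Complex.I) *
                  f ((z, z), (z, -z)) -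
                (Real.cos (Lam γ₁ γ₂ β₁) + Real.sin (Lam γ₁ γ₂ β₁) * Complex.I) *
                  f ((-z, -z), (z, -z)))))) := by
  have exp_neg_self (z : ℤˣ) := exp_pathExponent_neg_self γ₁ γ₂ β₁ β₂ (-z) z
  have exp_neg_neg (z : ℤˣ) := exp_pathExponent_neg_neg γ₁ γ₂ β₁ β₂ (-z) z
  simp only [neg_neg] at exp_neg_self exp_neg_neg
  rw [Fintype.sum_prod_type, Finset.sum_comm, sum_ketBra]
  refine Finset.sum_congr rfl fun z _ => ?_
  simp only [limitWeight, coreWeight_self, coreWeight_neg, mul_assoc, ← Finset.mul_sum,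
    sum_mixTransfer_self_mul, sum_mixTransfer_neg_mul, exp_pathExponent_self_self,
    exp_pathExponent_neg_self, exp_pathExponent_self_neg, exp_pathExponent_neg_neg, exp_neg_self,
    exp_neg_neg, spinVal_neg, Complex.ofReal_neg, neg_mul, mul_neg, sub_neg_eq_add]
  simp only [← mul_assoc (spinVal z : ℂ) (spinVal z : ℂ), ofReal_spinVal_mul_self, one_mul]
  ring

theorem sum_limitWeight_first_add :
    ∑ c, limitWeight γ₁ γ₂ β₁ β₂ c * (spinVal c.1.2 + spinVal c.1.1) =
      2 * (Real.cos (2 * β₁) * Real.cos (2 * β₂) - Real.exp (-2 * γ₂ ^ 2) * Real.sin (2 * β₁) *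
        Real.sin (2 * β₂) * Real.cos (Lam γ₁ γ₂ β₁)) := by
  simp only [sum_limitWeight_mul, sum_units _ 1, spinVal_neg, spinVal_one, neg_neg,
    Real.cos_two_mul' β₁]
  push_cast
  linear_combination (2 * Complex.sin (2 * β₁) * Complex.sin (2 * β₂) *
    Complex.exp (-2 * γ₂ ^ 2) * Complex.cos (Lam γ₁ γ₂ β₁)) * Complex.I_sq

theorem sum_limitWeight_first_sub :
    ∑ c, limitWeight γ₁ γ₂ β₁ β₂ c * (spinVal c.1.2 - spinVal c.1.1) =
      -2 * Complex.I * (Real.exp (-2 * γ₁ ^ 2) * Real.sin (2 * β₁) * Real.cos (2 * β₂) +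
        Real.exp (-2 * (γ₁ ^ 2 + γ₂ ^ 2)) * Real.sin (2 * β₂) *
          (Real.cos (2 * β₁) * Real.cosh (Omg γ₁ γ₂ β₁) - Real.sinh (Omg γ₁ γ₂ β₁))) := by
  simp only [sum_limitWeight_mul, sum_units _ 1, spinVal_neg, spinVal_one, neg_neg,
    Real.cos_two_mul' β₁]
  push_cast
  linear_combination (2 * Complex.I * Complex.sin (2 * β₂) *
    Complex.exp (-2 * (γ₁ ^ 2 + γ₂ ^ 2)) * Complex.sinh (Omg γ₁ γ₂ β₁)) *
      Complex.cos_sq_add_sin_sq (β₁ : ℂ)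

theorem sum_limitWeight_second_add :
    ∑ c, limitWeight γ₁ γ₂ β₁ β₂ c * (spinVal c.2.2 + spinVal c.2.1) =
      2 * Real.cos (2 * β₂) := by
  simp only [sum_limitWeight_mul, sum_units _ 1, spinVal_neg, spinVal_one, neg_neg]
  push_cast
  linear_combination (2 * Complex.cos (2 * β₂)) * Complex.cos_sq_add_sin_sq (β₁ : ℂ)

theorem sum_limitWeight_second_sub :
    ∑ c, limitWeight γ₁ γ₂ β₁ β₂ c * (spinVal c.2.2 - spinVal c.2.1) =
      -2 * Complex.I * Real.sin (2 * β₂) * (Real.exp (-2 * (γ₁ ^ 2 + γ₂ ^ 2)) *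
        (Real.cosh (Omg γ₁ γ₂ β₁) - Real.cos (2 * β₁) * Real.sinh (Omg γ₁ γ₂ β₁)) +
        Real.exp (-2 * γ₂ ^ 2) * Real.sin (2 * β₁) * Real.sin (Lam γ₁ γ₂ β₁)) := by
  simp only [sum_limitWeight_mul, sum_units _ 1, spinVal_neg, spinVal_one, neg_neg,
    Real.cos_two_mul' β₁]
  push_cast
  linear_combination (2 * Complex.I * Complex.sin (2 * β₂) * Complex.sin (2 * β₁) *
    Complex.exp (-2 * γ₂ ^ 2) * Complex.sin (Lam γ₁ γ₂ β₁)) * Complex.I_sq -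
    (2 * Complex.I * Complex.sin (2 * β₂) * Complex.exp (-2 * (γ₁ ^ 2 + γ₂ ^ 2)) *
      Complex.cosh (Omg γ₁ γ₂ β₁)) * Complex.cos_sq_add_sin_sq (β₁ : ℂ)

/-- Since `b' c' - b c = ((b' + b) (c' - c) + (b' - b) (c' + c)) / 2`, the phase factors over the
two measured qubits. -/
theorem sum_mul_mul_phase (w : SpinPath → ℂ) :
    ∑ c₁, ∑ c₂, w c₁ * w c₂ * phase γ₁ γ₂ c₁ c₂ =
      γ₁ * ((∑ c, w c * (spinVal c.1.2 + spinVal c.1.1)) *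
        ∑ c, w c * (spinVal c.1.2 - spinVal c.1.1)) +
      γ₂ * ((∑ c, w c * (spinVal c.2.2 + spinVal c.2.1)) *
        ∑ c, w c * (spinVal c.2.2 - spinVal c.2.1)) := by
  have bilinear (x y : SpinPath → ℝ) : ∑ c₁, ∑ c₂, w c₁ * w c₂ * (y c₁ * y c₂ - x c₁ * x c₂) =
      (∑ c, w c * (y c + x c)) * ∑ c, w c * (y c - x c) := by
    simp only [mul_add (w _), mul_sub (w _), Finset.sum_add_distrib, Finset.sum_sub_distrib]
    rw [← mul_self_sub_mul_self]
    simp only [Finset.sum_mul_sum, ← Finset.sum_sub_distrib]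
    exact Finset.sum_congr rfl fun _ _ => Finset.sum_congr rfl fun _ _ => by ring
  rw [← bilinear, ← bilinear]
  simp only [Finset.mul_sum, ← Finset.sum_add_distrib]
  refine Finset.sum_congr rfl fun _ _ => Finset.sum_congr rfl fun _ _ => ?_
  rw [phase, layerPhase, layerPhase]
  push_cast
  ring

theorem Gamma1_mul_exp :
    Gamma1 γ₁ γ₂ β₁ β₂ * Real.exp (-2 * (γ₁ ^ 2 + γ₂ ^ 2)) =
      2 * (Real.exp (-2 * γ₁ ^ 2) * Real.sin (2 * β₁) * Real.cos (2 * β₂) +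
        Real.exp (-2 * (γ₁ ^ 2 + γ₂ ^ 2)) * Real.sin (2 * β₂) *
          (Real.cos (2 * β₁) * Real.cosh (Omg γ₁ γ₂ β₁) - Real.sinh (Omg γ₁ γ₂ β₁))) *
        (Real.cos (2 * β₁) * Real.cos (2 * β₂) - Real.exp (-2 * γ₂ ^ 2) * Real.sin (2 * β₁) *
          Real.sin (2 * β₂) * Real.cos (Lam γ₁ γ₂ β₁)) := by
  have exp_eq : Real.exp (-2 * γ₁ ^ 2) =
      Real.exp (2 * γ₂ ^ 2) * Real.exp (-2 * (γ₁ ^ 2 + γ₂ ^ 2)) := by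
    rw [← Real.exp_add]
    ring_nf
  rw [exp_eq, Gamma1]
  ring

theorem Gamma2_mul_exp :
    Gamma2 γ₁ γ₂ β₁ β₂ * Real.exp (-2 * (γ₁ ^ 2 + γ₂ ^ 2)) =
      2 * Real.cos (2 * β₂) * Real.sin (2 * β₂) * (Real.exp (-2 * (γ₁ ^ 2 + γ₂ ^ 2)) *
        (Real.cosh (Omg γ₁ γ₂ β₁) - Real.cos (2 * β₁) * Real.sinh (Omg γ₁ γ₂ β₁)) +
        Real.exp (-2 * γ₂ ^ 2) * Real.sin (2 * β₁) * Real.sin (Lam γ₁ γ₂ β₁)) := by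
  have exp_eq : Real.exp (-2 * γ₂ ^ 2) =
      Real.exp (2 * γ₁ ^ 2) * Real.exp (-2 * (γ₁ ^ 2 + γ₂ ^ 2)) := by
    rw [← Real.exp_add]
    ring_nf
  have four_mul : 4 * β₂ = 2 * (2 * β₂) := by ring
  rw [exp_eq, Gamma2, four_mul, Real.sin_two_mul (2 * β₂)]
  ring

theorem sum_limitWeight_phase :
    Complex.I / 2 * ∑ c₁, ∑ c₂, limitWeight γ₁ γ₂ β₁ β₂ c₁ * limitWeight γ₁ γ₂ β₁ β₂ c₂ *
        phase γ₁ γ₂ c₁ c₂ =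
      (((γ₁ * Gamma1 γ₁ γ₂ β₁ β₂ + γ₂ * Gamma2 γ₁ γ₂ β₁ β₂) *
        Real.exp (-2 * (γ₁ ^ 2 + γ₂ ^ 2)) : ℝ) : ℂ) := by
  have I_mul_I (x₁ y₁ x₂ s₂ y₂ : ℂ) : Complex.I / 2 * (γ₁ * (2 * x₁ * (-2 * Complex.I * y₁)) +
      γ₂ * (2 * x₂ * (-2 * Complex.I * s₂ * y₂))) =
      γ₁ * (2 * y₁ * x₁) + γ₂ * (2 * x₂ * s₂ * y₂) := by
    linear_combination (-2 * γ₁ * x₁ * y₁ - 2 * γ₂ * x₂ * s₂ * y₂) * Complex.I_sq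
  rw [sum_mul_mul_phase, sum_limitWeight_first_add, sum_limitWeight_first_sub,
    sum_limitWeight_second_add, sum_limitWeight_second_sub, I_mul_I, add_mul, mul_assoc γ₁,
    mul_assoc γ₂, Gamma1_mul_exp, Gamma2_mul_exp]
  push_cast
  rfl

end Evaluation

/-! ### The limit of the energy density -/

section EnergyDensity

variable {μ : Measure ℝ} [IsProbabilityMeasure μ] (γ₁ γ₂ β₁ β₂ : ℝ)

theorem integrable_energyDensity (hμ : Integrable (fun x : ℝ => x) μ) (n : ℕ) :
    Integrable (fun J : Pairs n → ℝ => energyDensity J 2 ![γ₁, γ₂] ![β₁, β₂])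
      (couplingLaw μ n) := by
  simp only [energyDensity_two_eq]
  exact (integrable_finsetSum _ fun e _ => integrable_finsetSum _ fun q _ =>
    (integrable_mul_exp_sum hμ _).const_mul _).const_mul _

theorem integral_energyDensity (hμ : Integrable (fun x : ℝ => x) μ) (n : ℕ) :
    ∫ J : Pairs n → ℝ, energyDensity J 2 ![γ₁, γ₂] ![β₁, β₂] ∂(couplingLaw μ n) =
      1 / (n : ℂ) * (1 / Real.sqrt n : ℝ) * ∑ e : Pairs n, ∑ q,
        markedWeight (coreWeight β₁ β₂) (bulkWeight β₁ β₂)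
          (fun p q => -Complex.I * deriv (charFun μ) (phase γ₁ γ₂ p q / Real.sqrt n))
          (fun p q => charFun μ (phase γ₁ γ₂ p q / Real.sqrt n)) e.1.1 e.1.2 q := by
  have integrable_term (e : Pairs n) (q : Fin n → SpinPath) (w : ℂ) :=
    (integrable_mul_exp_sum (μ := fun _ : Pairs n => μ) (e := e) hμ
      fun e' => phase γ₁ γ₂ (q e'.1.1) (q e'.1.2) / Real.sqrt n).const_mul w
  have pair_eq_iff (e e' : Pairs n) : s(e'.1.1, e'.1.2) = s(e.1.1, e.1.2) ↔ e' = e := by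
    rw [← (pairsEquivSym2 n).injective.eq_iff, Subtype.ext_iff]
    rfl
  simp only [energyDensity_two_eq, couplingLaw]
  rw [integral_const_mul, integral_finsetSum _ fun e _ => integrable_finsetSum _ fun q _ =>
    integrable_term e q _]
  congr 1
  refine Finset.sum_congr rfl fun e _ => ?_
  rw [integral_finsetSum _ fun q _ => integrable_term e q _]
  refine Finset.sum_congr rfl fun q _ => ?_
  rw [integral_const_mul, integral_mul_exp_sum hμ, markedWeight]
  simp only [pair_eq_iff]

theorem inv_mul_inv_sqrt_mul_card_pairs (n : ℕ) :
    1 / (n : ℂ) * (1 / Real.sqrt n : ℝ) * Fintype.card (Pairs n) =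
      (1 - (n : ℂ)⁻¹) / 2 * (Real.sqrt n : ℂ) := by
  obtain rfl | n_pos := n.eq_zero_or_pos
  · simp
  have card_eq : (2 : ℂ) * Fintype.card (Pairs n) = n * (n - 1) := by
    rw [← Nat.cast_pred n_pos]
    exact_mod_cast two_mul_card_pairs n
  have sqrt_mul_sqrt : (Real.sqrt n : ℂ) * Real.sqrt n = n := by
    exact_mod_cast Real.mul_self_sqrt n.cast_nonneg
  have n_ne : (n : ℂ) ≠ 0 := Nat.cast_ne_zero.2 n_pos.ne'
  have sqrt_ne : (Real.sqrt n : ℂ) ≠ 0 := left_ne_zero_of_mul (sqrt_mul_sqrt ▸ n_ne)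
  push_cast
  field_simp
  rw [pow_two, sqrt_mul_sqrt, mul_comm, card_eq]

theorem integral_energyDensity_add_two (hμ : Integrable (fun x : ℝ => x) μ) (m : ℕ) :
    ∫ J, energyDensity J 2 ![γ₁, γ₂] ![β₁, β₂] ∂(couplingLaw μ (m + 2)) =
      ∑ c₁, ∑ c₂, coreWeight β₁ β₂ c₁ * coreWeight β₁ β₂ c₂ *
        ((1 - ((m + 2 : ℕ) : ℂ)⁻¹) / 2 * (-Complex.I * ((Real.sqrt (m + 2 : ℕ) : ℂ) *
          deriv (charFun μ) (phase γ₁ γ₂ c₁ c₂ / Real.sqrt (m + 2 : ℕ)))) *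
        bulkSum μ γ₁ γ₂ β₁ β₂ m c₁ c₂) := by
  have sum_eq (e : Pairs (m + 2)) := sum_markedWeight_eq
    (u := coreWeight β₁ β₂) (v := bulkWeight β₁ β₂)
    (G := fun p q => -Complex.I * deriv (charFun μ) (phase γ₁ γ₂ p q / Real.sqrt (m + 2 : ℕ)))
    (F := fun p q => charFun μ (phase γ₁ γ₂ p q / Real.sqrt (m + 2 : ℕ)))
    (fun p q => by rw [phase_comm]) (fun p q => by rw [phase_comm]) e.2.ne zero_ne_one
  rw [integral_energyDensity γ₁ γ₂ β₁ β₂ hμ]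
  simp only [sum_eq, sum_markedWeight_zero_one, Finset.sum_const, Finset.card_univ, nsmul_eq_mul]
  rw [← mul_assoc, inv_mul_inv_sqrt_mul_card_pairs, Finset.mul_sum]
  refine Finset.sum_congr rfl fun c₁ _ => ?_
  rw [Finset.mul_sum]
  refine Finset.sum_congr rfl fun c₂ _ => ?_
  rw [bulkSum]
  ring

theorem tendsto_integral_energyDensity (hL2 : MemLp (fun x : ℝ => x) 2 μ)
    (hmean : ∫ x, x ∂μ = 0) (hvar : ∫ x, x ^ 2 ∂μ = 1) :
    Tendsto (fun n => ∫ J, energyDensity J 2 ![γ₁, γ₂] ![β₁, β₂] ∂(couplingLaw μ n)) atTop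
      (𝓝 (Complex.I / 2 * ∑ c₁, ∑ c₂, limitWeight γ₁ γ₂ β₁ β₂ c₁ * limitWeight γ₁ γ₂ β₁ β₂ c₂ *
        phase γ₁ γ₂ c₁ c₂)) := by
  rw [← tendsto_add_atTop_iff_nat 2]
  simp only [integral_energyDensity_add_two γ₁ γ₂ β₁ β₂ (hL2.integrable one_le_two),
    Finset.mul_sum]
  refine tendsto_finsetSum _ fun c₁ _ => tendsto_finsetSum _ fun c₂ _ => ?_
  have tendsto_fraction : Tendsto (fun m : ℕ => (1 - ((m + 2 : ℕ) : ℂ)⁻¹) / 2) atTop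
      (𝓝 (1 / 2)) := by
    have h := (tendsto_inv_atTop_nhds_zero_nat (𝕜 := ℂ)).comp (tendsto_add_atTop_nat 2)
    simpa using (h.const_sub 1).div_const 2
  have tendsto_deriv := ((tendsto_sqrt_mul_deriv_charFun hL2 hmean hvar
    (phase γ₁ γ₂ c₁ c₂)).comp (tendsto_add_atTop_nat 2)).const_mul (-Complex.I)
  have limit_eq : Complex.I / 2 * (limitWeight γ₁ γ₂ β₁ β₂ c₁ * limitWeight γ₁ γ₂ β₁ β₂ c₂ *
      phase γ₁ γ₂ c₁ c₂) =
      coreWeight β₁ β₂ c₁ * coreWeight β₁ β₂ c₂ * (1 / 2 * (-Complex.I * -phase γ₁ γ₂ c₁ c₂) *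
        Complex.exp (pathExponent γ₁ γ₂ β₁ β₂ c₁ + pathExponent γ₁ γ₂ β₁ β₂ c₂)) := by
    rw [limitWeight, limitWeight, Complex.exp_add]
    ring
  rw [limit_eq]
  exact ((tendsto_fraction.mul tendsto_deriv).mul
    (tendsto_bulkSum γ₁ γ₂ β₁ β₂ hmean hvar c₁ c₂)).const_mul _

end EnergyDensity

end SKQAOA

theorem mainTheorem4 (μ : MeasureTheory.Measure ℝ) [MeasureTheory.IsProbabilityMeasure μ]
    (hL2 : MeasureTheory.MemLp (fun x : ℝ => x) 2 μ)
    (hmean : ∫ x, x ∂μ = 0) (hvar : ∫ x, x ^ 2 ∂μ = 1)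
    (γ₁ γ₂ β₁ β₂ : ℝ) :
    (∀ n : ℕ, MeasureTheory.Integrable
      (fun J : SKQAOA.Pairs n → ℝ => SKQAOA.energyDensity J 2 ![γ₁, γ₂] ![β₁, β₂])
      (SKQAOA.couplingLaw μ n)) ∧
    Filter.Tendsto
      (fun n : ℕ => ∫ J, SKQAOA.energyDensity J 2 ![γ₁, γ₂] ![β₁, β₂] ∂(SKQAOA.couplingLaw μ n))
      Filter.atTop
      (nhds (((γ₁ * SKQAOA.Gamma1 γ₁ γ₂ β₁ β₂ + γ₂ * SKQAOA.Gamma2 γ₁ γ₂ β₁ β₂)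
        * Real.exp (-2 * (γ₁ ^ 2 + γ₂ ^ 2)) : ℝ) : ℂ)) := by
  refine ⟨SKQAOA.integrable_energyDensity γ₁ γ₂ β₁ β₂ (hL2.integrable one_le_two), ?_⟩
  rw [← SKQAOA.sum_limitWeight_phase]
  exact SKQAOA.tendsto_integral_energyDensity γ₁ γ₂ β₁ β₂ hL2 hmean hvar
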